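/- Let $J\subseteq\mathbb{R}$ be an open interval (for instance $J=\mathbb{R}$), let $\mathtt{v}:J\to(0,\infty)$ be continuously differentiable, let $x_0,y_0\in J$ and $\lambda>0$. Consider the planar random motion $(X(t),Y(t))$ in $J\times J$ with the four orthogonal directions $d_j=(\cos(\pi j/2),\sin(\pi j/2))$, $j\in\mathbb{Z}$ (so $d_{j+4}=d_j$). It starts at $(x_0,y_0)$ along one of the four directions, chosen with probability $1/4$ each. At the events of a homogeneous Poisson process $N$ of intensity $\lambda$ it turns from its current direction $d_j$ to $d_{j+1}$ or to $d_{j-1}$, with probability $1/2$ each; the initial direction, the turns and $N$ are independent. The paths are continuous and, between direction changes, satisfy $X'(t)=\pm\mathtt{v}(X(t))$, $Y'(t)=0$ while moving horizontally and $X'(t)=0$, $Y'(t)=\pm\mathtt{v}(Y(t))$ while moving vertically, with the sign given by the direction. Let $T>0$ be such that the motion almost surely exists in $J\times J$ on $[0,T]$ (if the endpoints of $J$ cannot be reached in finite time, every $T>0$ is allowed). For $0<t\le T$ let $R_t$ be the (topological) support of the law of $(X(t),Y(t))$. Then in the interior of $R_t$ this law is absolutely continuous with density $$f(x,y,t)=\frac{e^{-\lambda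 t}}{2\,\mathtt{v}(x)\,\mathtt{v}(y)}\left[\frac{\lambda}{2}I_0\!\left(\frac{\lambda}{2}\sqrt{t^2-a_+^2}\right)+\frac{\partial}{\partial t}I_0\!\left(\frac{\lambda}{2}\sqrt{t^2-a_+^2}\right)\right]\left[\frac{\lambda}{2}I_0\!\left(\frac{\lambda}{2}\sqrt{t^2-a_-^2}\right)+\frac{\partial}{\partial t}I_0\!\left(\frac{\lambda}{2}\sqrt{t^2-a_-^2}\right)\right],$$ where $$a_\pm=a_\pm(x,y)=\int_{x_0}^x\frac{dz}{\mathtt{v}(z)}\pm\int_{y_0}^y\frac{dz}{\mathtt{v}(z)},\qquad I_0(z)=\sum_{k\ge0}\frac{(z/2)^{2k}}{(k!)^2}.$$ That is, $\mathrm{Int}(R_t)\subseteq J\times J$, the $t$-derivatives exist for every $(x,y)\in\mathrm{Int}(R_t)$, $f(\cdot,\cdot,t)$ is integrable on $\mathrm{Int}(R_t)$, and $\mathbb{P}\big((X(t),Y(t))\in A\big)=\iint_A f(x,y,t)\,dx\,dy$ for every Borel set $A\subseteq\mathrm{Int}(R_t)$. -/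

import Mathlib

open MeasureTheory ProbabilityTheory Set Filter Topology
open scoped NNReal

noncomputable section

/-- The modified Bessel function of the first kind of order zero,
`I₀(z) = ∑ₖ (z/2)^{2k} / (k!)²`. -/
def besselI0 (z : ℝ) : ℝ :=
  ∑' k : ℕ, (z / 2) ^ (2 * k) / (Nat.factorial k : ℝ) ^ 2

/-- A homogeneous Poisson process with intensity `lam`: a counting process (almost surely started
at `0`, nondecreasing and right-continuous) with independent increments, whose increment over
`[s, t]` has the Poisson law of parameter `lam * (t - s)`. As almost every path is nondecreasing,
the subtraction of natural numbers is the true one almost surely. -/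
structure IsPoissonProcess {Ω : Type*} [MeasurableSpace Ω] (P : Measure Ω) (lam : ℝ≥0)
    (N : ℝ≥0 → Ω → ℕ) : Prop where
  measurable : ∀ t, Measurable (N t)
  zero : ∀ᵐ ω ∂P, N 0 ω = 0
  mono : ∀ᵐ ω ∂P, Monotone fun t => N t ω
  rightCont : ∀ᵐ ω ∂P, ∀ t, ContinuousWithinAt (fun s => N s ω) (Ici t) t
  indep : HasIndepIncrements N P
  law : ∀ s t, s ≤ t → HasLaw (fun ω => N t ω - N s ω) (poissonMeasure (lam * (t - s))) P

/-- The random mechanism that drives the direction: a Poisson process `N` of intensity `lam`, an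
initial direction index `J₀` uniform on `{0, 1, 2, 3}`, and turns `ε k` (the turn made at the
`(k + 1)`-st Poisson event), which are independent and equal to `+1` (counterclockwise) or `-1`
(clockwise) with probability `1/2` each; `N`, `J₀` and `(ε k)ₖ` are independent. -/
structure IsDirectionMechanism {Ω : Type*} [MeasurableSpace Ω] (P : Measure Ω) (lam : ℝ≥0)
    (N : ℝ≥0 → Ω → ℕ) (J₀ : Ω → ℤ) (ε : ℕ → Ω → ℤ) : Prop where
  poisson : IsPoissonProcess P lam N
  measurable_init : Measurable J₀
  init_law : ∀ j : Fin 4, P {ω | J₀ ω = (j : ℕ)} = 1 / 4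
  measurable_turn : ∀ k, Measurable (ε k)
  turn_left : ∀ k, P {ω | ε k ω = 1} = 1 / 2
  turn_right : ∀ k, P {ω | ε k ω = -1} = 1 / 2
  indep_turns : iIndepFun ε P
  indep_init : IndepFun J₀ (fun ω k => ε k ω) P
  indep_poisson : IndepFun (fun ω t => N t ω) (fun ω => (J₀ ω, fun k => ε k ω)) P

/-- The index `j` (to be read modulo `4`) of the direction `d_j` at time `t`: the initial index
plus the turns made at the Poisson events up to time `t`. -/
def dirIndex {Ω : Type*} (N : ℝ≥0 → Ω → ℕ) (J₀ : Ω → ℤ) (ε : ℕ → Ω → ℤ) (t : ℝ) (ω : Ω) : ℤ :=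
  J₀ ω + ∑ k ∈ Finset.range (N t.toNNReal ω), ε k ω

/-- `(X, Y)` is, on the time interval `[0, T]`, the planar motion started at `(x₀, y₀)` with the
directions `d_j = (cos (π j / 2), sin (π j / 2))` and with velocity `v (X t)` while it moves
horizontally and `v (Y t)` while it moves vertically; `J` is the interval where the velocity
function `v` lives. Almost every path is continuous, stays in `J × J`, and satisfies the equation
of motion at every time at which the direction is not being changed (i.e. around which the
Poisson process is constant). -/
structure IsPlanarMotion {Ω : Type*} [MeasurableSpace Ω] (P : Measure Ω) (J : Set ℝ) (v : ℝ → ℝ)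
    (N : ℝ≥0 → Ω → ℕ) (J₀ : Ω → ℤ) (ε : ℕ → Ω → ℤ) (x₀ y₀ T : ℝ) (X Y : ℝ → Ω → ℝ) : Prop where
  measurable_X : ∀ t ∈ Icc 0 T, Measurable (X t)
  measurable_Y : ∀ t ∈ Icc 0 T, Measurable (Y t)
  init : ∀ᵐ ω ∂P, X 0 ω = x₀ ∧ Y 0 ω = y₀
  mem : ∀ᵐ ω ∂P, ∀ t ∈ Icc 0 T, X t ω ∈ J ∧ Y t ω ∈ J
  cont : ∀ᵐ ω ∂P, ContinuousOn (fun t => X t ω) (Icc 0 T) ∧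
    ContinuousOn (fun t => Y t ω) (Icc 0 T)
  motion : ∀ᵐ ω ∂P, ∀ t ∈ Ioo 0 T, (∀ᶠ s : ℝ in 𝓝 t, N s.toNNReal ω = N t.toNNReal ω) →
    HasDerivAt (fun s => X s ω)
      (v (X t ω) * Real.cos (Real.pi * (dirIndex N J₀ ε t ω : ℝ) / 2)) t ∧
    HasDerivAt (fun s => Y s ω)
      (v (Y t ω) * Real.sin (Real.pi * (dirIndex N J₀ ε t ω : ℝ) / 2)) t

/-- The integral `∫_a^x dz / v(z)`. -/
def travelTime (v : ℝ → ℝ) (a x : ℝ) : ℝ := ∫ z in a..x, 1 / v z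

/-- The function `t ↦ I₀ ((lam / 2) √(t² - a²))`. -/
def besselTerm (lam a t : ℝ) : ℝ := besselI0 (lam / 2 * Real.sqrt (t ^ 2 - a ^ 2))

/-- The factor `(lam / 2) I₀(·) + ∂ₜ I₀(·)` with argument `(lam / 2) √(t² - a²)`. -/
def besselFactor (lam a t : ℝ) : ℝ :=
  lam / 2 * besselTerm lam a t + deriv (fun s => besselTerm lam a s) t

/-- The density of the planar motion at time `t`. -/
def planarDensity (lam : ℝ) (v : ℝ → ℝ) (x₀ y₀ t : ℝ) (z : ℝ × ℝ) : ℝ :=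
  Real.exp (-lam * t) / (2 * v z.1 * v z.2) *
    besselFactor lam (travelTime v x₀ z.1 + travelTime v y₀ z.2) t *
    besselFactor lam (travelTime v x₀ z.1 - travelTime v y₀ z.2) t

end

/-! Measure each coordinate by its travel time, U = ∫ dz/v from x₀ to X and V = ∫ dz/v from y₀ to Y.
Both then move at unit speed, and U + V and U - V have velocities s = cos + sin and d = cos - sin of
the direction, each equal to ±1. A turn flips exactly one of s and d, and as the turns are fair each
is equally likely to be the one that flips. So U + V and U - V are independent telegraph processes
of rate lam / 2. Such a process has atoms at ±t and a Bessel density on (-t, t); the product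
density, pulled back through the map (x, y) ↦ (U + V, U - V) with Jacobian 2 / (v(x) v(y)), is the
asserted formula.

Independence is read off the joint characteristic function rather than from a thinning of the
Poisson process. The functions 1, s, d and sd of the direction are eigenfunctions of the average
over one turn, with eigenvalues 1, 0, 0, -1; over a Poisson time h they are damped by 1, e^{-lam h},
e^{-lam h}, e^{-2 lam h}. Since s² = d² = 1, their span is stable under multiplication by the phase
of a time step. On a time grid the joint characteristic function therefore factorises exactly into
two copies of a scheme in ℂ that alternates damping and rotation (`integral_walkProd`).

This scheme is a Lie–Trotter splitting of a real-linear ODE and converges to its solution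
(`tendsto_iterate_splitStep`). The solution is explicit (`hasDerivAt_telegraphSol`), because the
kernel I₀ solves a Klein–Gordon equation, and it gives the characteristic function of the telegraph
law (`charFun_telegraphLaw`). Uniqueness of characteristic functions yields the product law
(`map_eq_telegraphLaw_prod`).

It remains to locate the interior of the support: it is mapped into the open square (-t, t)²
(`IsPlanarMotion.mem_of_mem_interior_support`), away from the atoms and where the Bessel terms are
differentiable. -/

/-! ### Bessel series -/

/-- The entire function `∑ₖ wᵏ / (k! (k+m)!)`, which is `I_m(2√w) / √w ^ m` for `w > 0`. -/
noncomputable def besselSeries (m : ℕ) (w : ℝ) : ℝ :=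
  ∑' k : ℕ, w ^ k / ((Nat.factorial k : ℝ) * (Nat.factorial (k + m) : ℝ))

lemma summable_besselSeries (m : ℕ) (w : ℝ) :
    Summable fun k : ℕ => w ^ k / ((Nat.factorial k : ℝ) * (Nat.factorial (k + m) : ℝ)) := by
  refine Summable.of_norm_bounded (Real.summable_pow_div_factorial |w|) fun k => ?_
  have h1 : (1 : ℝ) ≤ (Nat.factorial (k + m) : ℝ) := by exact_mod_cast Nat.factorial_pos _
  have h2 : (0 : ℝ) < (Nat.factorial k : ℝ) := by exact_mod_cast Nat.factorial_pos _
  rw [norm_div, norm_pow, Real.norm_eq_abs, norm_mul, Real.norm_of_nonneg h2.le,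
    Real.norm_of_nonneg (by linarith)]
  gcongr
  nlinarith

/-- Termwise differentiation on a bounded interval around `w`; the factor `k` cancels against `k!`,
which shifts the second factorial and so raises the index. -/
lemma hasDerivAt_besselSeries (m : ℕ) (w : ℝ) :
    HasDerivAt (besselSeries m) (besselSeries (m + 1) w) w := by
  set R := |w| + 1
  have hR : 0 ≤ R := by positivity
  have hu : Summable fun k : ℕ => (k : ℝ) * R ^ (k - 1) / (Nat.factorial k : ℝ) := by
    rw [← summable_nat_add_iff 1]
    refine (Real.summable_pow_div_factorial R).congr fun k => ?_
    rw [Nat.factorial_succ, Nat.add_sub_cancel]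
    push_cast
    field_simp
  have hder : ∀ (k : ℕ) (y : ℝ), y ∈ Ioo (-R) R →
      HasDerivAt (fun y : ℝ => y ^ k / ((Nat.factorial k : ℝ) * (Nat.factorial (k + m) : ℝ)))
        ((k : ℝ) * y ^ (k - 1) / ((Nat.factorial k : ℝ) * (Nat.factorial (k + m) : ℝ))) y :=
    fun k y _ => (hasDerivAt_pow k y).div_const _
  have hw : w ∈ Ioo (-R) R := abs_lt.mp (by simp [R])
  have key := hasDerivAt_tsum_of_isPreconnected hu isOpen_Ioo isPreconnected_Ioo hder
    (fun k y hy => ?_) hw (summable_besselSeries m w) hw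
  · refine key.congr_deriv ?_
    have hs : Summable fun k : ℕ =>
        (k : ℝ) * w ^ (k - 1) / ((Nat.factorial k : ℝ) * (Nat.factorial (k + m) : ℝ)) := by
      rw [← summable_nat_add_iff 1]
      refine (summable_besselSeries (m + 1) w).congr fun k => ?_
      rw [Nat.factorial_succ, Nat.add_sub_cancel, show k + 1 + m = k + (m + 1) by ring]
      push_cast
      field_simp
    rw [hs.tsum_eq_zero_add, besselSeries]
    simp only [CharP.cast_eq_zero, zero_mul, zero_div, zero_add]
    refine tsum_congr fun k => ?_
    rw [Nat.factorial_succ, Nat.add_sub_cancel, show k + 1 + m = k + (m + 1) by ring]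
    push_cast
    field_simp
  · have h1 : (1 : ℝ) ≤ (Nat.factorial (k + m) : ℝ) := by exact_mod_cast Nat.factorial_pos _
    have h2 : (0 : ℝ) < (Nat.factorial k : ℝ) := by exact_mod_cast Nat.factorial_pos _
    have hy' : |y| ≤ R := (abs_lt.mpr hy).le
    rw [norm_div, norm_mul, norm_mul, norm_pow, Real.norm_eq_abs y, Real.norm_of_nonneg h2.le,
      Real.norm_of_nonneg (by linarith : (0 : ℝ) ≤ (Nat.factorial (k + m) : ℝ)),
      Real.norm_of_nonneg (Nat.cast_nonneg k)]
    gcongr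
    nlinarith

lemma besselSeries_zero (m : ℕ) : besselSeries m 0 = 1 / (Nat.factorial m : ℝ) := by
  rw [besselSeries, tsum_eq_single 0]
  · simp
  · intro k hk
    simp [hk]

/-- Since differentiation raises the index, this is the Bessel equation w g'' + g' = g for g =
`besselSeries 0`. -/
lemma besselSeries_recurrence (w : ℝ) :
    besselSeries 1 w + w * besselSeries 2 w = besselSeries 0 w := by
  have h := (summable_besselSeries 0 w).sub (summable_besselSeries 1 w)
  have h2 : besselSeries 0 w - besselSeries 1 w = w * besselSeries 2 w := by
    rw [besselSeries, besselSeries, ← (summable_besselSeries 0 w).tsum_sub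
      (summable_besselSeries 1 w), h.tsum_eq_zero_add, besselSeries, ← tsum_mul_left]
    simp only [Nat.factorial]
    norm_num
    refine tsum_congr fun k => ?_
    have h3 := Nat.factorial_ne_zero k
    field_simp
    ring
  linarith

lemma besselSeries_nonneg (m : ℕ) {w : ℝ} (hw : 0 ≤ w) : 0 ≤ besselSeries m w :=
  tsum_nonneg fun _ => by positivity

@[fun_prop]
lemma continuous_besselSeries (m : ℕ) : Continuous (besselSeries m) :=
  continuous_iff_continuousAt.mpr fun w => (hasDerivAt_besselSeries m w).continuousAt

lemma besselTerm_eq (lam : ℝ) {a s : ℝ} (h : a ^ 2 ≤ s ^ 2) :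
    besselTerm lam a s = besselSeries 0 (lam ^ 2 / 16 * (s ^ 2 - a ^ 2)) := by
  rw [besselTerm, besselI0, besselSeries]
  refine tsum_congr fun k => ?_
  have : (lam / 2 * Real.sqrt (s ^ 2 - a ^ 2) / 2) ^ 2 = lam ^ 2 / 16 * (s ^ 2 - a ^ 2) := by
    rw [div_pow, mul_pow, Real.sq_sqrt (by linarith)]
    ring
  rw [pow_mul, this, add_zero, sq (Nat.factorial k : ℝ)]

lemma hasDerivAt_besselSeries_comp (m : ℕ) (kap a s : ℝ) :
    HasDerivAt (fun s : ℝ => besselSeries m (kap * (s ^ 2 - a ^ 2)))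
      (besselSeries (m + 1) (kap * (s ^ 2 - a ^ 2)) * (2 * kap * s)) s := by
  have h : HasDerivAt (fun s : ℝ => kap * (s ^ 2 - a ^ 2)) (2 * kap * s) s := by
    refine (((hasDerivAt_pow 2 s).sub_const (a ^ 2)).const_mul kap).congr_deriv ?_
    push_cast
    ring
  exact (hasDerivAt_besselSeries m _).comp s h

lemma hasDerivAt_besselSeries_comp' (m : ℕ) (kap s x : ℝ) :
    HasDerivAt (fun x : ℝ => besselSeries m (kap * (s ^ 2 - x ^ 2)))
      (besselSeries (m + 1) (kap * (s ^ 2 - x ^ 2)) * (-(2 * kap * x))) x := by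
  have h : HasDerivAt (fun x : ℝ => kap * (s ^ 2 - x ^ 2)) (-(2 * kap * x)) x := by
    refine (((hasDerivAt_pow 2 x).const_sub (s ^ 2)).const_mul kap).congr_deriv ?_
    push_cast
    ring
  exact (hasDerivAt_besselSeries m _).comp x h

/-- The square root agrees with the entire function only where a² ≤ s²; the strict inequality |a| <
t secures this in a neighbourhood of t. -/
lemma hasDerivAt_besselTerm (lam : ℝ) {a t : ℝ} (ha : |a| < t) :
    HasDerivAt (besselTerm lam a)
      (besselSeries 1 (lam ^ 2 / 16 * (t ^ 2 - a ^ 2)) * (2 * (lam ^ 2 / 16) * t)) t := by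
  refine (hasDerivAt_besselSeries_comp 0 (lam ^ 2 / 16) a t).congr_of_eventuallyEq ?_
  filter_upwards [lt_mem_nhds ha] with s hs
  exact besselTerm_eq lam (sq_le_sq' (by linarith [neg_abs_le a]) (by linarith [le_abs_self a]))

/-- The series form of `besselFactor`, valid for `|a| < t`. -/
noncomputable def besselFactorSeries (lam t a : ℝ) : ℝ :=
  lam / 2 * besselSeries 0 (lam ^ 2 / 16 * (t ^ 2 - a ^ 2)) +
    besselSeries 1 (lam ^ 2 / 16 * (t ^ 2 - a ^ 2)) * (2 * (lam ^ 2 / 16) * t)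

lemma besselFactor_eq (lam : ℝ) {a t : ℝ} (ha : |a| < t) :
    besselFactor lam a t = besselFactorSeries lam t a := by
  rw [besselFactor, (hasDerivAt_besselTerm lam ha).deriv, besselTerm_eq, besselFactorSeries]
  exact sq_le_sq' (by linarith [neg_abs_le a]) (by linarith [le_abs_self a])

@[fun_prop]
lemma continuous_besselFactorSeries (lam t : ℝ) : Continuous (besselFactorSeries lam t) := by
  unfold besselFactorSeries
  fun_prop

lemma besselFactorSeries_nonneg {lam t a : ℝ} (hlam : 0 ≤ lam) (ht : 0 ≤ t) (ha : |a| ≤ t) :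
    0 ≤ besselFactorSeries lam t a := by
  have h : 0 ≤ lam ^ 2 / 16 * (t ^ 2 - a ^ 2) :=
    mul_nonneg (by positivity) (by
      linarith [sq_le_sq' (by linarith [neg_abs_le a]) (by linarith [le_abs_self a] : a ≤ t)])
  have h0 := besselSeries_nonneg 0 h
  have h1 := besselSeries_nonneg 1 h
  unfold besselFactorSeries
  positivity

/-! ### The Bessel solution of the telegraph equation -/

/-- **Leibniz integral rule** with a moving endpoint. -/
lemma hasDerivAt_integral_moving {f f' : ℝ → ℝ → ℝ} (hf : Continuous (Function.uncurry f))
    (hf' : Continuous (Function.uncurry f')) (hd : ∀ s x, HasDerivAt (fun s => f s x) (f' s x) s)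
    (s : ℝ) :
    HasDerivAt (fun s => ∫ x in (0 : ℝ)..s, f s x) (f s s + ∫ x in (0 : ℝ)..s, f' s x) s := by
  have hpar : ∀ u s : ℝ, HasDerivAt (fun s => ∫ x in (0 : ℝ)..u, f s x)
      (∫ x in (0 : ℝ)..u, f' s x) s := by
    intro u s
    obtain ⟨M, hM⟩ := (isCompact_Icc.prod isCompact_uIcc : IsCompact
      (Icc (s - 1) (s + 1) ×ˢ uIcc (0 : ℝ) u)).exists_bound_of_continuousOn hf'.continuousOn
    refine (intervalIntegral.hasDerivAt_integral_of_dominated_loc_of_deriv_le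
      (F := f) (F' := f') (bound := fun _ => M)
      (Icc_mem_nhds (by linarith : s - 1 < s) (by linarith : s < s + 1))
      (Eventually.of_forall fun r => ?_) ?_ ?_ ?_ ?_ ?_).2
    · exact (hf.comp (by fun_prop : Continuous fun x : ℝ => (r, x))).aestronglyMeasurable
    · exact (hf.comp (by fun_prop : Continuous fun x : ℝ => (s, x))).intervalIntegrable _ _
    · exact (hf'.comp (by fun_prop : Continuous fun x : ℝ => (s, x))).aestronglyMeasurable
    · exact Eventually.of_forall fun x hx r hr => hM (r, x) ⟨hr, uIoc_subset_uIcc hx⟩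
    · exact intervalIntegrable_const
    · exact Eventually.of_forall fun x _ r _ => hd r x
  have hmov : ∀ u s : ℝ, HasDerivAt (fun u => ∫ x in (0 : ℝ)..u, f s x) (f s u) u := fun u s =>
    (hf.comp (by fun_prop : Continuous fun x : ℝ => (s, x))).integral_hasStrictDerivAt 0 u
      |>.hasDerivAt
  -- Continuous partial derivatives give joint differentiability in the parameter and the endpoint;
  -- the claim is the chain rule along the diagonal.
  have key := hasStrictFDerivAt_uncurry_coprod (𝕜 := ℝ) (u := (s, s))
    (f := fun s u => ∫ x in (0 : ℝ)..u, f s x)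
    (f₁ := fun s u => ContinuousLinearMap.toSpanSingleton ℝ (∫ x in (0 : ℝ)..u, f' s x))
    (f₂ := fun s u => ContinuousLinearMap.toSpanSingleton ℝ (f s u))
    (Eventually.of_forall fun v => (hpar v.2 v.1).hasFDerivAt)
    (Eventually.of_forall fun v => (hmov v.2 v.1).hasFDerivAt) ?_ ?_
  · have h := HasFDerivAt.comp_hasDerivAt (f := fun s : ℝ => (s, s)) s key.hasFDerivAt
      ((hasDerivAt_id' s).prodMk (hasDerivAt_id' s))
    simpa [Function.HasUncurry.uncurry, add_comm, Function.comp_def] using h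
  · refine Continuous.continuousAt ?_
    have : Continuous fun p : ℝ × ℝ => ∫ x in (0 : ℝ)..p.2, f' p.1 x :=
      intervalIntegral.continuous_parametric_primitive_of_continuous hf'
    exact (ContinuousLinearMap.toSpanSingletonCLE (𝕜 := ℝ) (E := ℝ)).continuous.comp this
  · exact ((ContinuousLinearMap.toSpanSingletonCLE (𝕜 := ℝ) (E := ℝ)).continuous.comp
      hf).continuousAt

/-- `∫₀ˢ cos(ξx) I₀(2√(κ(s²-x²))) dx`. -/
noncomputable def cosBessel (kap xi s : ℝ) : ℝ :=
  ∫ x in (0 : ℝ)..s, Real.cos (xi * x) * besselSeries 0 (kap * (s ^ 2 - x ^ 2))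

/-- The derivative of `cosBessel` in the variable `s`. -/
noncomputable def cosBesselDeriv (kap xi s : ℝ) : ℝ :=
  Real.cos (xi * s) + ∫ x in (0 : ℝ)..s,
    Real.cos (xi * x) * (besselSeries 1 (kap * (s ^ 2 - x ^ 2)) * (2 * kap * s))

lemma hasDerivAt_cosBessel (kap xi s : ℝ) :
    HasDerivAt (cosBessel kap xi) (cosBesselDeriv kap xi s) s := by
  have h := hasDerivAt_integral_moving
    (f := fun s x => Real.cos (xi * x) * besselSeries 0 (kap * (s ^ 2 - x ^ 2)))
    (f' := fun s x => Real.cos (xi * x) *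
      (besselSeries 1 (kap * (s ^ 2 - x ^ 2)) * (2 * kap * s)))
    (by fun_prop) (by fun_prop)
    (fun s x => (hasDerivAt_besselSeries_comp 0 kap x s).const_mul _) s
  refine h.congr_deriv ?_
  simp [cosBesselDeriv, besselSeries_zero]

/-- The kernel G(s, x) = I₀(2√(κ(s² - x²))) satisfies G_ss - G_xx = 4κG. Integrating cos(ξx) G_xx by
parts twice turns this into an ordinary differential equation in s. -/
lemma hasDerivAt_cosBesselDeriv (kap xi s : ℝ) :
    HasDerivAt (cosBesselDeriv kap xi) ((4 * kap - xi ^ 2) * cosBessel kap xi s) s := by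
  have h := hasDerivAt_integral_moving
    (f := fun s x => Real.cos (xi * x) *
      (besselSeries 1 (kap * (s ^ 2 - x ^ 2)) * (2 * kap * s)))
    (f' := fun s x => Real.cos (xi * x) *
      (besselSeries 2 (kap * (s ^ 2 - x ^ 2)) * (2 * kap * s) * (2 * kap * s) +
        besselSeries 1 (kap * (s ^ 2 - x ^ 2)) * (2 * kap)))
    (by fun_prop) (by fun_prop)
    (fun s x => by
      have h1 : HasDerivAt (fun s : ℝ => 2 * kap * s) (2 * kap) s := by
        simpa using (hasDerivAt_id s).const_mul (2 * kap)
      exact ((hasDerivAt_besselSeries_comp 1 kap x s).mul h1).const_mul _) s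
  have hc : ∀ x : ℝ, HasDerivAt (fun s : ℝ => Real.cos (xi * s)) (-Real.sin (xi * x) * xi) x :=
    fun x => by simpa using ((hasDerivAt_id' x).const_mul xi).cos
  have hs : ∀ x : ℝ, HasDerivAt (fun s : ℝ => Real.sin (xi * s)) (Real.cos (xi * x) * xi) x :=
    fun x => by simpa using ((hasDerivAt_id' x).const_mul xi).sin
  refine ((hc s).add h).congr_deriv ?_
  -- The function cos(ξx) G_x + ξ sin(ξx) G encodes both integrations by parts; it vanishes at x =
  -- 0, and its value at x = s cancels the boundary terms of the Leibniz rule.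
  have hF : ∀ x : ℝ, HasDerivAt (fun x : ℝ =>
      Real.cos (xi * x) * (besselSeries 1 (kap * (s ^ 2 - x ^ 2)) * (-(2 * kap * x))) +
        xi * (Real.sin (xi * x) * besselSeries 0 (kap * (s ^ 2 - x ^ 2))))
      (Real.cos (xi * x) * (besselSeries 2 (kap * (s ^ 2 - x ^ 2)) * (2 * kap * s) * (2 * kap * s) +
        besselSeries 1 (kap * (s ^ 2 - x ^ 2)) * (2 * kap)) -
        (4 * kap - xi ^ 2) * (Real.cos (xi * x) * besselSeries 0 (kap * (s ^ 2 - x ^ 2)))) x := by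
    intro x
    have h1 : HasDerivAt (fun x : ℝ => -(2 * kap * x)) (-(2 * kap)) x := by
      simpa using ((hasDerivAt_id' x).const_mul (2 * kap)).fun_neg
    refine (((hc x).mul ((hasDerivAt_besselSeries_comp' 1 kap s x).mul h1)).add
      (((hs x).mul (hasDerivAt_besselSeries_comp' 0 kap s x)).const_mul xi)).congr_deriv ?_
    have hr := besselSeries_recurrence (kap * (s ^ 2 - x ^ 2))
    rw [← hr]
    simp only [Pi.mul_apply]
    ring
  have hI := intervalIntegral.integral_eq_sub_of_hasDerivAt (a := 0) (b := s)
    (fun x _ => hF x) (Continuous.intervalIntegrable (by fun_prop) _ _)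
  rw [intervalIntegral.integral_sub (Continuous.intervalIntegrable (by fun_prop) _ _)
    (Continuous.intervalIntegrable (by fun_prop) _ _), intervalIntegral.integral_const_mul] at hI
  rw [sub_eq_iff_eq_add] at hI
  rw [hI, cosBessel]
  simp [besselSeries_zero]
  ring

/-- The characteristic function at `ξ` of the telegraph process of rate `lam / 2`, together with
that of the process weighted by its velocity: the solution `z = a + iβ` of
`a' = -ξβ`, `β' = ξa - lam β`, `z(0) = 1`. -/
noncomputable def telegraphSol (lam xi s : ℝ) : ℂ :=
  ⟨Real.exp (-(lam / 2) * s) *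
      (lam / 2 * cosBessel (lam ^ 2 / 16) xi s + cosBesselDeriv (lam ^ 2 / 16) xi s),
    xi * Real.exp (-(lam / 2) * s) * cosBessel (lam ^ 2 / 16) xi s⟩

lemma telegraphSol_zero (lam xi : ℝ) : telegraphSol lam xi 0 = 1 := by
  apply Complex.ext <;> simp [telegraphSol, cosBessel, cosBesselDeriv]

/-- With κ = lam²/16 the integral S = `cosBessel` solves S'' = (lam²/4 - ξ²) S; the factor e^{-lam
s/2} absorbs the term lam²/4, which leaves the system for (a, β). -/
lemma hasDerivAt_telegraphSol (lam xi s : ℝ) :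
    HasDerivAt (telegraphSol lam xi)
      (Complex.I * xi * telegraphSol lam xi s -
        Complex.I * lam * ((telegraphSol lam xi s).im : ℂ)) s := by
  have he : HasDerivAt (fun s : ℝ => Real.exp (-(lam / 2) * s))
      (Real.exp (-(lam / 2) * s) * (-(lam / 2))) s := by
    simpa using ((hasDerivAt_id' s).const_mul (-(lam / 2))).exp
  have hS := hasDerivAt_cosBessel (lam ^ 2 / 16) xi s
  have hC := hasDerivAt_cosBesselDeriv (lam ^ 2 / 16) xi s
  have ha : HasDerivAt (fun s => (telegraphSol lam xi s).re)
      (-xi * (telegraphSol lam xi s).im) s := by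
    refine (he.mul ((hS.const_mul (lam / 2)).add hC)).congr_deriv ?_
    simp only [telegraphSol, Pi.add_apply]
    ring
  have hb : HasDerivAt (fun s => (telegraphSol lam xi s).im)
      (xi * (telegraphSol lam xi s).re - lam * (telegraphSol lam xi s).im) s := by
    refine ((he.const_mul xi).mul hS).congr_deriv ?_
    simp only [telegraphSol]
    ring
  have h := ha.ofReal_comp.add (hb.ofReal_comp.mul_const Complex.I)
  refine (h.congr_of_eventuallyEq (Eventually.of_forall fun s =>
    (Complex.re_add_im _).symm)).congr_deriv ?_
  apply Complex.ext <;> simp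

/-! ### The telegraph law and its characteristic function -/

/-- The absolutely continuous part of the law of the telegraph process. -/
noncomputable def telegraphDensity (lam t x : ℝ) : ℝ :=
  Real.exp (-(lam / 2) * t) / 2 * besselFactorSeries lam t x

@[fun_prop]
lemma continuous_telegraphDensity (lam t : ℝ) : Continuous (telegraphDensity lam t) := by
  unfold telegraphDensity
  fun_prop

lemma telegraphDensity_nonneg {lam t a : ℝ} (hlam : 0 ≤ lam) (ht : 0 ≤ t) (ha : |a| ≤ t) :
    0 ≤ telegraphDensity lam t a :=
  mul_nonneg (by positivity) (besselFactorSeries_nonneg hlam ht ha)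

lemma telegraphDensity_neg (lam t x : ℝ) :
    telegraphDensity lam t (-x) = telegraphDensity lam t x := by
  simp [telegraphDensity, besselFactorSeries]

lemma integrableOn_telegraphDensity (lam t : ℝ) :
    IntegrableOn (telegraphDensity lam t) (Ioo (-t) t) :=
  ((continuous_telegraphDensity lam t).integrableOn_Icc).mono_set Ioo_subset_Icc_self

/-- The law at time `t` of the telegraph process of rate `lam / 2` with symmetric initial
direction. -/
noncomputable def telegraphLaw (lam t : ℝ) : Measure ℝ :=
  (Real.exp (-(lam / 2) * t) / 2).toNNReal • (Measure.dirac t + Measure.dirac (-t)) +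
    (volume.restrict (Ioo (-t) t)).withDensity fun x => ENNReal.ofReal (telegraphDensity lam t x)

instance isFiniteMeasure_telegraphLaw (lam t : ℝ) : IsFiniteMeasure (telegraphLaw lam t) := by
  have := isFiniteMeasure_withDensity_ofReal (integrableOn_telegraphDensity lam t).2
  unfold telegraphLaw
  infer_instance

lemma integral_exp_mul_telegraphDensity {lam t : ℝ} (ht : 0 ≤ t) (xi : ℝ) :
    ∫ x in Ioo (-t) t, (telegraphDensity lam t x : ℂ) * Complex.exp (xi * x * Complex.I) =
      ((2 * ∫ x in (0 : ℝ)..t, Real.cos (xi * x) * telegraphDensity lam t x : ℝ) : ℂ) := by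
  rw [← integral_Ioc_eq_integral_Ioo, ← intervalIntegral.integral_of_le (by linarith)]
  have hint : ∀ a b : ℝ, IntervalIntegrable
      (fun x : ℝ => (telegraphDensity lam t x : ℂ) * Complex.exp (xi * x * Complex.I)) volume a b :=
    fun a b => Continuous.intervalIntegrable (by fun_prop) _ _
  rw [← intervalIntegral.integral_add_adjacent_intervals (hint (-t) 0) (hint 0 t)]
  have hneg := intervalIntegral.integral_comp_neg (a := 0) (b := t)
    (fun x : ℝ => (telegraphDensity lam t x : ℂ) * Complex.exp (xi * x * Complex.I))
  rw [neg_zero] at hneg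
  rw [← hneg, ← intervalIntegral.integral_add
    (Continuous.intervalIntegrable (by fun_prop) _ _) (hint 0 t)]
  rw [← intervalIntegral.integral_const_mul, ← intervalIntegral.integral_ofReal]
  refine intervalIntegral.integral_congr fun x _ => ?_
  simp only [telegraphDensity_neg]
  push_cast
  rw [Complex.cos]
  ring_nf

lemma charFun_telegraphLaw {lam t : ℝ} (hlam : 0 ≤ lam) (ht : 0 ≤ t) (xi : ℝ) :
    charFun (telegraphLaw lam t) xi = ((telegraphSol lam xi t).re : ℂ) := by
  have hfin := isFiniteMeasure_withDensity_ofReal (integrableOn_telegraphDensity lam t).2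
  have hint : ∀ (μ : Measure ℝ) [IsFiniteMeasure μ],
      Integrable (fun x : ℝ => Complex.exp (xi * x * Complex.I)) μ := by
    intro μ _
    refine Integrable.of_bound (by fun_prop) 1 (Eventually.of_forall fun x => ?_)
    rw [← Complex.ofReal_mul, Complex.norm_exp_ofReal_mul_I]
  rw [charFun_apply_real, telegraphLaw, integral_add_measure (hint _) (hint _),
    integral_smul_nnreal_measure, integral_add_measure (hint _) (hint _), integral_dirac,
    integral_dirac, integral_withDensity_eq_integral_toReal_smul (by fun_prop)
      (Eventually.of_forall fun x => ENNReal.ofReal_lt_top)]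
  have hcongr : ∫ x in Ioo (-t) t, (ENNReal.ofReal (telegraphDensity lam t x)).toReal •
      Complex.exp (xi * x * Complex.I) =
      ∫ x in Ioo (-t) t, (telegraphDensity lam t x : ℂ) * Complex.exp (xi * x * Complex.I) := by
    refine setIntegral_congr_fun measurableSet_Ioo fun x hx => ?_
    rw [ENNReal.toReal_ofReal (telegraphDensity_nonneg hlam ht (abs_le.mpr ⟨hx.1.le, hx.2.le⟩)),
      Complex.real_smul]
  rw [hcongr, integral_exp_mul_telegraphDensity ht, NNReal.smul_def,
    Real.coe_toNNReal _ (by positivity), Complex.real_smul]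
  have hcos : Complex.exp (xi * t * Complex.I) + Complex.exp (xi * (-t : ℝ) * Complex.I) =
      ((2 * Real.cos (xi * t) : ℝ) : ℂ) := by
    push_cast
    rw [Complex.cos]
    ring_nf
  rw [hcos, ← Complex.ofReal_mul, ← Complex.ofReal_add]
  congr 1
  -- The density misses exactly the boundary term cos(ξt) of `cosBesselDeriv`; the two atoms supply
  -- it.
  have hI : ∫ x in (0 : ℝ)..t, Real.cos (xi * x) * telegraphDensity lam t x =
      Real.exp (-(lam / 2) * t) / 2 * (lam / 2 * cosBessel (lam ^ 2 / 16) xi t +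
        (cosBesselDeriv (lam ^ 2 / 16) xi t - Real.cos (xi * t))) := by
    rw [cosBesselDeriv, add_sub_cancel_left, cosBessel, ← intervalIntegral.integral_const_mul,
      ← intervalIntegral.integral_add (Continuous.intervalIntegrable (by fun_prop) _ _)
        (Continuous.intervalIntegrable (by fun_prop) _ _), ← intervalIntegral.integral_const_mul]
    refine intervalIntegral.integral_congr fun x _ => ?_
    simp only [telegraphDensity, besselFactorSeries]
    ring
  rw [hI, telegraphSol]
  ring

lemma telegraphLaw_singleton_ne_zero (lam t : ℝ) :
    telegraphLaw lam t {t} ≠ 0 ∧ telegraphLaw lam t {-t} ≠ 0 := by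
  have h : (Real.exp (-(lam / 2) * t) / 2).toNNReal ≠ 0 :=
    (Real.toNNReal_pos.mpr (by positivity)).ne'
  constructor <;>
  · rw [telegraphLaw, Measure.add_apply, Measure.smul_apply, Measure.add_apply]
    intro h0
    simp only [add_eq_zero, smul_eq_zero, h, false_or] at h0
    simp at h0

lemma telegraphLaw_compl_Icc {lam t : ℝ} (ht : 0 ≤ t) :
    telegraphLaw lam t (Icc (-t) t)ᶜ = 0 := by
  have h : ((volume.restrict (Ioo (-t) t)).withDensity
      fun x => ENNReal.ofReal (telegraphDensity lam t x)) (Icc (-t) t)ᶜ = 0 := by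
    refine withDensity_absolutelyContinuous _ _ ?_
    rw [Measure.restrict_apply measurableSet_Icc.compl]
    convert measure_empty (μ := (volume : Measure ℝ))
    ext x
    simp only [mem_inter_iff, mem_compl_iff, mem_Icc, mem_Ioo, mem_empty_iff_false, iff_false]
    exact fun hx => hx.1 ⟨hx.2.1.le, hx.2.2.le⟩
  simp [telegraphLaw, h, measurableSet_Icc.compl, ht]

lemma telegraphLaw_restrict_Ioo (lam t : ℝ) :
    (telegraphLaw lam t).restrict (Ioo (-t) t) = (volume.restrict (Ioo (-t) t)).withDensity
      fun x => ENNReal.ofReal (telegraphDensity lam t x) := by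
  rw [telegraphLaw, Measure.restrict_add, Measure.restrict_smul, Measure.restrict_add,
    restrict_dirac' measurableSet_Ioo, restrict_dirac' measurableSet_Ioo,
    restrict_withDensity measurableSet_Ioo, Measure.restrict_restrict measurableSet_Ioo]
  simp

/-! ### Convergence of the splitting scheme -/

/-- One step of the alternation of the damping `a + iβ ↦ a + i e^{-lam h} β` and the rotation by
the angle `h ξ`. -/
noncomputable def splitStep (lam xi h : ℝ) (u : ℂ) : ℂ :=
  Complex.exp (h * xi * Complex.I) * (u.re + Complex.I * (Real.exp (-lam * h) * u.im : ℝ))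

/-- Stability: the rotation is an isometry and the damping a contraction, so errors of earlier steps
are not amplified. -/
lemma norm_splitStep_sub_le {lam h : ℝ} (hl : 0 ≤ lam) (hh : 0 ≤ h) (xi : ℝ) (u w : ℂ) :
    ‖splitStep lam xi h u - splitStep lam xi h w‖ ≤ ‖u - w‖ := by
  have he : Real.exp (-lam * h) ≤ 1 := Real.exp_le_one_iff.mpr (by nlinarith)
  have hpos := Real.exp_pos (-lam * h)
  rw [splitStep, splitStep]
  generalize Real.exp (-lam * h) = d at he hpos
  rw [← mul_sub, norm_mul, ← Complex.ofReal_mul,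
    Complex.norm_exp_ofReal_mul_I, one_mul, Complex.norm_def, Complex.norm_def]
  refine Real.sqrt_le_sqrt ?_
  simp only [Complex.normSq_apply]
  simp
  have h1 : (d * u.im - d * w.im) ^ 2 ≤ (u.im - w.im) ^ 2 := by
    rw [← mul_sub, mul_pow]
    exact mul_le_of_le_one_left (sq_nonneg _) (by nlinarith)
  nlinarith

lemma abs_one_sub_exp_neg_le {x : ℝ} (hx : 0 ≤ x) : |Real.exp (-x) - 1| ≤ x := by
  rw [abs_le]
  constructor
  · linarith [Real.add_one_le_exp (-x)]
  · linarith [Real.exp_le_one_iff.mpr (neg_nonpos.mpr hx)]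

/-- The local error of `splitStep` is quadratic. -/
lemma norm_splitStep_sub_flow_le {lam : ℝ} (hl : 0 ≤ lam) {xi : ℝ} {z : ℝ → ℂ}
    (hz : ∀ s, HasDerivAt z (Complex.I * xi * z s - Complex.I * lam * ((z s).im : ℂ)) s)
    {K t : ℝ} (hK : ∀ s ∈ Icc 0 t, ‖z s‖ ≤ K) {s h : ℝ} (hs : 0 ≤ s) (hh : 0 ≤ h)
    (hst : s + h ≤ t) :
    ‖splitStep lam xi h (z s) - z (s + h)‖ ≤ 2 * lam * (|xi| + lam) * K * h ^ 2 := by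
  have hK0 : 0 ≤ K := (norm_nonneg _).trans (hK s ⟨hs, by linarith⟩)
  have him : ∀ s ∈ Icc 0 t, |(z s).im| ≤ K := fun s hs =>
    (Complex.abs_im_le_norm _).trans (hK s hs)
  have hLip : ∀ r ∈ Icc 0 h, ‖z (s + r) - z s‖ ≤ (|xi| + lam) * K * r := by
    intro r hr
    have := norm_image_sub_le_of_norm_deriv_le_segment' (f := fun r => z (s + r)) (a := 0) (b := h)
      (C := (|xi| + lam) * K) (f' := fun r => Complex.I * xi * z (s + r) -
        Complex.I * lam * ((z (s + r)).im : ℂ))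
      (fun r _ => ((hz (s + r)).comp_const_add s r).hasDerivWithinAt) (fun r hr => ?_) r hr
    · simpa using this
    · have hmem : s + r ∈ Icc 0 t := ⟨by linarith [hr.1], by linarith [hr.2]⟩
      refine (norm_sub_le _ _).trans ?_
      simp only [norm_mul, Complex.norm_I, one_mul, Complex.norm_real, Real.norm_eq_abs,
        abs_of_nonneg hl]
      rw [add_mul]
      gcongr
      · exact hK _ hmem
      · exact him _ hmem
  have hexp : ∀ r : ℝ, HasDerivAt (fun r : ℝ => Complex.exp (-(r * xi * Complex.I)))
      (Complex.exp (-(r * xi * Complex.I)) * (-(xi * Complex.I))) r := by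
    intro r
    have := (((hasDerivAt_id' r).ofReal_comp.mul_const (xi : ℂ)).mul_const Complex.I).fun_neg.cexp
    simpa using this
  have hdamp : ∀ r : ℝ, HasDerivAt (fun r : ℝ => Real.exp (-lam * r) * (z s).im)
      (Real.exp (-lam * r) * (-lam) * (z s).im) r := by
    intro r
    simpa using (((hasDerivAt_id' r).const_mul (-lam)).exp).mul_const (z s).im
  -- The flow is rotated back, so that g measures only the discrepancy in the damping. It vanishes
  -- at 0 and its derivative is O(h), whence the quadratic bound.
  set g : ℝ → ℂ := fun r => ((z s).re + Complex.I * (Real.exp (-lam * r) * (z s).im : ℝ)) -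
    Complex.exp (-(r * xi * Complex.I)) * z (s + r) with hg
  have hgd : ∀ r : ℝ, HasDerivAt g (Complex.I * lam * (Complex.exp (-(r * xi * Complex.I)) *
      ((z (s + r)).im : ℂ) - (Real.exp (-lam * r) * (z s).im : ℝ))) r := by
    intro r
    refine ((((hdamp r).ofReal_comp.const_mul Complex.I).const_add ((z s).re : ℂ)).sub
      ((hexp r).mul ((hz (s + r)).comp_const_add s r))).congr_deriv ?_
    push_cast
    ring
  have hgb : ∀ r ∈ Ico 0 h, ‖Complex.I * lam * (Complex.exp (-(r * xi * Complex.I)) *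
      ((z (s + r)).im : ℂ) - (Real.exp (-lam * r) * (z s).im : ℝ))‖ ≤
      2 * lam * (|xi| + lam) * K * h := by
    intro r hr
    have hsmem : s ∈ Icc 0 t := ⟨hs, by linarith⟩
    have hsrmem : s + r ∈ Icc 0 t := ⟨by linarith [hr.1], by linarith [hr.2]⟩
    have e1 : ‖Complex.exp (-(r * xi * Complex.I)) - 1‖ ≤ |xi| * r := by
      have := Real.norm_exp_I_mul_ofReal_sub_one_le (x := -(r * xi))
      rw [Real.norm_eq_abs, abs_neg, abs_mul, abs_of_nonneg hr.1, mul_comm r |xi|] at this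
      refine le_of_eq_of_le (congrArg (fun w => ‖Complex.exp w - 1‖) ?_) this
      push_cast
      ring
    have e2 := (Complex.abs_im_le_norm _).trans (hLip r ⟨hr.1, hr.2.le⟩)
    rw [Complex.sub_im] at e2
    have e3 := abs_one_sub_exp_neg_le (mul_nonneg hl hr.1)
    rw [← neg_mul] at e3
    -- Three deviations, each O(r): of the rotation from 1, of the flow from its starting point, and
    -- of the damping factor from 1. Their bounds add up to 2(|ξ| + lam) K r.
    have hsplit : Complex.exp (-(r * xi * Complex.I)) * ((z (s + r)).im : ℂ) -
        (Real.exp (-lam * r) * (z s).im : ℝ) =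
        (Complex.exp (-(r * xi * Complex.I)) - 1) * ((z (s + r)).im : ℂ) +
          (((z (s + r)).im - (z s).im : ℝ) : ℂ) -
          (((Real.exp (-lam * r) - 1) * (z s).im : ℝ) : ℂ) := by
      push_cast
      ring
    rw [norm_mul, norm_mul, Complex.norm_I, one_mul, Complex.norm_real, Real.norm_eq_abs,
      abs_of_nonneg hl, hsplit]
    have e4 : ‖(Complex.exp (-(r * xi * Complex.I)) - 1) * ((z (s + r)).im : ℂ) +
          (((z (s + r)).im - (z s).im : ℝ) : ℂ) -
          (((Real.exp (-lam * r) - 1) * (z s).im : ℝ) : ℂ)‖ ≤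
        |xi| * r * K + (|xi| + lam) * K * r + lam * r * K := by
      refine (norm_sub_le _ _).trans (add_le_add ((norm_add_le _ _).trans (add_le_add ?_ ?_)) ?_)
      · rw [norm_mul, Complex.norm_real, Real.norm_eq_abs]
        exact mul_le_mul e1 (him _ hsrmem) (abs_nonneg _) (mul_nonneg (abs_nonneg _) hr.1)
      · rw [Complex.norm_real]
        exact e2
      · rw [Complex.norm_real, Real.norm_eq_abs, abs_mul]
        exact mul_le_mul e3 (him _ hsmem) (abs_nonneg _) (mul_nonneg hl hr.1)
    calc lam * _ ≤ lam * (2 * (|xi| + lam) * K * h) := by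
          refine mul_le_mul_of_nonneg_left (e4.trans ?_) hl
          have : 2 * (|xi| + lam) * K * r ≤ 2 * (|xi| + lam) * K * h := by
            have := hr.2.le
            gcongr
          linarith
      _ = _ := by ring
  have hfin := norm_image_sub_le_of_norm_deriv_le_segment' (f := g) (a := 0) (b := h)
    (fun r _ => (hgd r).hasDerivWithinAt) hgb h ⟨hh, le_rfl⟩
  have hg0 : g 0 = 0 := by
    simp [hg, mul_comm Complex.I]
  have hgh : splitStep lam xi h (z s) - z (s + h) = Complex.exp (h * xi * Complex.I) * g h := by
    rw [splitStep, hg]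
    simp only
    rw [mul_sub, ← mul_assoc (Complex.exp _) (Complex.exp _), ← Complex.exp_add, add_neg_cancel,
      Complex.exp_zero, one_mul]
  rw [hgh, norm_mul, ← Complex.ofReal_mul, Complex.norm_exp_ofReal_mul_I, one_mul]
  rw [hg0, sub_zero, sub_zero] at hfin
  linarith

/-- Convergence of the splitting scheme. -/
lemma tendsto_iterate_splitStep {lam : ℝ} (hl : 0 ≤ lam) {xi : ℝ} {z : ℝ → ℂ}
    (hz : ∀ s, HasDerivAt z (Complex.I * xi * z s - Complex.I * lam * ((z s).im : ℂ)) s)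
    {t : ℝ} (ht : 0 ≤ t) :
    Tendsto (fun n : ℕ => (splitStep lam xi (t / n))^[n] (z 0)) atTop (𝓝 (z t)) := by
  obtain ⟨K, hK⟩ := isCompact_Icc.exists_bound_of_continuousOn (s := Icc 0 t)
    (fun s _ => (hz s).continuousAt.continuousWithinAt)
  set C := 2 * lam * (|xi| + lam) * K
  rw [tendsto_iff_norm_sub_tendsto_zero]
  refine squeeze_zero' (Eventually.of_forall fun n => norm_nonneg _) ?_
    (tendsto_const_div_atTop_nhds_zero_nat (C * t ^ 2))
  filter_upwards [eventually_gt_atTop 0] with n hn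
  have hn' : (0 : ℝ) < n := by exact_mod_cast hn
  have hh : 0 ≤ t / n := by positivity
  -- Local errors accumulate at most additively; n of them, each C (t/n)², give C t²/n.
  have hind : ∀ k : ℕ, k ≤ n →
      ‖(splitStep lam xi (t / n))^[k] (z 0) - z (k * (t / n))‖ ≤ k * (C * (t / n) ^ 2) := by
    intro k
    induction k with
    | zero => simp
    | succ k ih =>
      intro hk
      have hkn : (k : ℝ) + 1 ≤ n := by exact_mod_cast hk
      have h1 := norm_splitStep_sub_flow_le hl hz hK (s := k * (t / n)) (by positivity) hh (by
        calc (k : ℝ) * (t / n) + t / n = (k + 1) * (t / n) := by ring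
          _ ≤ n * (t / n) := by gcongr
          _ = t := by field_simp)
      have h2 := norm_splitStep_sub_le hl hh xi ((splitStep lam xi (t / n))^[k] (z 0))
        (z (k * (t / n)))
      have h3 := ih (by omega)
      rw [Function.iterate_succ_apply', Nat.cast_succ, add_one_mul, add_one_mul]
      calc _ ≤ _ := norm_sub_le_norm_sub_add_norm_sub _
            (splitStep lam xi (t / n) (z (k * (t / n)))) _
        _ ≤ _ := add_le_add (h2.trans h3) h1
  have h := hind n le_rfl
  rw [mul_div_cancel₀ _ hn'.ne'] at h
  refine h.trans (le_of_eq ?_)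
  field_simp

/-! ### The walk of directions and the signs of its velocities -/

/-- The direction index after `n` turns, `p` being the initial index and the sequence of turns. -/
def dirSum (p : ℤ × (ℕ → ℤ)) (n : ℕ) : ℤ := p.1 + ∑ k ∈ Finset.range n, p.2 k

/-- Forget all turns but the first `q`. -/
def truncTurns (q : ℕ) (p : ℤ × (ℕ → ℤ)) : ℤ × (ℕ → ℤ) := (p.1, fun k => if k < q then p.2 k else 0)

lemma dirSum_succ (p : ℤ × (ℕ → ℤ)) (n : ℕ) : dirSum p (n + 1) = dirSum p n + p.2 n := by
  rw [dirSum, dirSum, Finset.sum_range_succ, add_assoc]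

lemma dirSum_truncTurns {q n : ℕ} (h : n ≤ q) (p : ℤ × (ℕ → ℤ)) :
    dirSum (truncTurns q p) n = dirSum p n := by
  simp only [dirSum, truncTurns]
  congr 1
  refine Finset.sum_congr rfl fun k hk => ?_
  rw [if_pos (by have := Finset.mem_range.mp hk; omega)]

@[fun_prop]
lemma measurable_dirSum (n : ℕ) : Measurable fun p => dirSum p n := by
  unfold dirSum
  fun_prop

lemma measurable_dirSum_uncurry : Measurable fun z : ℕ × (ℤ × (ℕ → ℤ)) => dirSum z.2 z.1 :=
  measurable_from_prod_countable_right fun n => measurable_dirSum n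

lemma measurable_truncTurns (q : ℕ) : Measurable (truncTurns q) := by
  unfold truncTurns
  refine measurable_fst.prodMk (measurable_pi_lambda _ fun k => ?_)
  split_ifs <;> fun_prop

/-- The sign `cos + sin` of the velocity of `U + V`. -/
noncomputable def sumSign (j : ℤ) : ℝ :=
  Real.cos (Real.pi * (j : ℝ) / 2) + Real.sin (Real.pi * (j : ℝ) / 2)

/-- The sign `cos - sin` of the velocity of `U - V`. -/
noncomputable def diffSign (j : ℤ) : ℝ :=
  Real.cos (Real.pi * (j : ℝ) / 2) - Real.sin (Real.pi * (j : ℝ) / 2)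

/-- A left turn acts on the pair (s, d) as (s, d) ↦ (d, -s), and a right turn by the inverse. As
both entries are ±1, either turn flips exactly one of them. -/
lemma sumSign_add_one (j : ℤ) : sumSign (j + 1) = diffSign j := by
  have h : Real.pi * ((j + 1 : ℤ) : ℝ) / 2 = Real.pi * (j : ℝ) / 2 + Real.pi / 2 := by
    push_cast; ring
  rw [sumSign, diffSign, h, Real.cos_add_pi_div_two, Real.sin_add_pi_div_two]
  ring

lemma diffSign_add_one (j : ℤ) : diffSign (j + 1) = -sumSign j := by
  have h : Real.pi * ((j + 1 : ℤ) : ℝ) / 2 = Real.pi * (j : ℝ) / 2 + Real.pi / 2 := by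
    push_cast; ring
  rw [sumSign, diffSign, h, Real.cos_add_pi_div_two, Real.sin_add_pi_div_two]
  ring

lemma diffSign_sub_one (j : ℤ) : diffSign (j - 1) = sumSign j := by
  rw [← sumSign_add_one, sub_add_cancel]

lemma sumSign_sub_one (j : ℤ) : sumSign (j - 1) = -diffSign j := by
  have := diffSign_add_one (j - 1)
  rw [sub_add_cancel] at this
  rw [this, neg_neg]

lemma sumSign_diffSign_zero : sumSign 0 = 1 ∧ diffSign 0 = 1 := by
  simp [sumSign, diffSign]

lemma sumSign_diffSign_sq (j : ℤ) : sumSign j ^ 2 = 1 ∧ diffSign j ^ 2 = 1 := by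
  induction j using Int.induction_on with
  | zero => simp [sumSign_diffSign_zero]
  | succ i ih => rw [sumSign_add_one, diffSign_add_one, neg_sq]; exact ih.symm
  | pred i ih => rw [sumSign_sub_one, diffSign_sub_one, neg_sq]; exact ih.symm

lemma abs_sumSign (j : ℤ) : |sumSign j| = 1 := by
  rw [abs_eq zero_le_one]
  exact sq_eq_one_iff.mp (sumSign_diffSign_sq j).1

lemma abs_diffSign (j : ℤ) : |diffSign j| = 1 := by
  rw [← sumSign_add_one, abs_sumSign]

/-! ### Fubini and independence -/

section Fubini

variable {Ω α β γ : Type*} [MeasurableSpace Ω] [MeasurableSpace α] [MeasurableSpace β]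
  [MeasurableSpace γ] {P : Measure Ω} [IsProbabilityMeasure P]

/-- Used to freeze the Poisson counts while averaging over the initial direction and the turns. -/
lemma integral_eq_integral_integral_of_indepFun {X : Ω → α} {Y : Ω → β} (hX : Measurable X)
    (hY : Measurable Y) (h : IndepFun X Y P) {F : α → β → ℂ} (hF : Measurable (Function.uncurry F))
    {C : ℝ} (hC : ∀ a b, ‖F a b‖ ≤ C) :
    ∫ ω, F (X ω) (Y ω) ∂P = ∫ ω, ∫ ω', F (X ω) (Y ω') ∂P ∂P := by
  have hmap := (indepFun_iff_map_prod_eq_prod_map_map hX.aemeasurable hY.aemeasurable).mp h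
  have : IsProbabilityMeasure (P.map X) := Measure.isProbabilityMeasure_map hX.aemeasurable
  have : IsProbabilityMeasure (P.map Y) := Measure.isProbabilityMeasure_map hY.aemeasurable
  calc ∫ ω, F (X ω) (Y ω) ∂P
      = ∫ z, Function.uncurry F z ∂(P.map fun ω => (X ω, Y ω)) := by
        rw [integral_map (by fun_prop) hF.aestronglyMeasurable]
        rfl
    _ = ∫ a, ∫ b, F a b ∂(P.map Y) ∂(P.map X) := by
        rw [hmap, integral_prod]
        · rfl
        · exact Integrable.of_bound hF.aestronglyMeasurable C
            (Eventually.of_forall fun z => hC z.1 z.2)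
    _ = ∫ a, ∫ ω', F a (Y ω') ∂P ∂(P.map X) := by
        refine integral_congr_ae (Eventually.of_forall fun a => ?_)
        simp only
        exact integral_map hY.aemeasurable
          (hF.comp (measurable_prodMk_left (x := a))).aestronglyMeasurable
    _ = _ := by
        rw [integral_map hX.aemeasurable]
        refine StronglyMeasurable.aestronglyMeasurable ?_
        exact StronglyMeasurable.integral_prod_right (f := fun a ω' => F a (Y ω'))
          (hF.comp (measurable_fst.prodMk (hY.comp measurable_snd))).stronglyMeasurable

/-- Both hypotheses together say that the joint law is a triple product, and triple products
reassociate. -/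
lemma indepFun_prodMk_left_of_indepFun {A : Ω → α} {B : Ω → β} {C : Ω → γ} (hA : Measurable A)
    (hB : Measurable B) (hC : Measurable C) (h : IndepFun A (fun ω => (B ω, C ω)) P)
    (hBC : IndepFun B C P) : IndepFun (fun ω => (A ω, B ω)) C P := by
  have hAB : IndepFun A B P := h.comp measurable_id measurable_fst
  rw [indepFun_iff_map_prod_eq_prod_map_map (by fun_prop) (by fun_prop)] at h hBC hAB ⊢
  have := Measure.isProbabilityMeasure_map hA.aemeasurable (μ := P)
  have := Measure.isProbabilityMeasure_map hB.aemeasurable (μ := P)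
  have := Measure.isProbabilityMeasure_map hC.aemeasurable (μ := P)
  rw [hAB]
  rw [hBC] at h
  have h2 := congrArg (Measure.map MeasurableEquiv.prodAssoc.symm) h
  rw [Measure.map_map (by fun_prop) (by fun_prop)] at h2
  have h3 := (measurePreserving_prodAssoc (P.map A) (P.map B) (P.map C)).symm
  rw [h3.map_eq] at h2
  exact h2

end Fubini

/-! ### Averaging over the turns -/

section Turns

variable {Ω : Type*} [MeasurableSpace Ω] {P : Measure Ω} {lam : ℝ≥0}
  {N : ℝ≥0 → Ω → ℕ} {J₀ : Ω → ℤ} {ε : ℕ → Ω → ℤ}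

lemma IsDirectionMechanism.measurable_pair (hD : IsDirectionMechanism P lam N J₀ ε) :
    Measurable fun ω => (J₀ ω, fun k => ε k ω) :=
  hD.measurable_init.prodMk (measurable_pi_lambda _ hD.measurable_turn)

lemma integral_ite_eq {Z : Ω → ℤ} (hZ : Measurable Z) (c : ℤ) :
    ∫ ω, (if Z ω = c then 1 else 0 : ℂ) ∂P = (P.real {ω | Z ω = c} : ℂ) := by
  have hm : MeasurableSet {ω | Z ω = c} := hZ (measurableSet_singleton c)
  have : (fun ω => (if Z ω = c then 1 else 0 : ℂ)) =
      {ω | Z ω = c}.indicator fun _ => (1 : ℂ) := by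
    funext ω
    simp [indicator_apply]
  rw [this, integral_indicator_const _ hm]
  simp

variable [IsProbabilityMeasure P]

/-- The next turn is independent of the past: the initial index is independent of all turns
together, and the turn q of the earlier ones. -/
lemma IsDirectionMechanism.indepFun_truncTurns (hD : IsDirectionMechanism P lam N J₀ ε) (q : ℕ) :
    IndepFun (fun ω => truncTurns q (J₀ ω, fun k => ε k ω)) (ε q) P := by
  have hmε : Measurable fun ω k => ε k ω := measurable_pi_lambda _ hD.measurable_turn
  have hB : Measurable fun (e : ℕ → ℤ) (k : ℕ) => if k < q then e k else 0 :=
    measurable_pi_lambda _ fun k => by split_ifs <;> fun_prop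
  refine indepFun_prodMk_left_of_indepFun (A := J₀)
    (B := fun ω k => if k < q then ε k ω else 0) hD.measurable_init (hB.comp hmε)
    (hD.measurable_turn q) ?_ ?_
  · exact hD.indep_init.comp measurable_id (hB.prodMk (measurable_pi_apply q))
  · have h := hD.indep_turns.indepFun_finset (Finset.range q) {q} (by simp) hD.measurable_turn
    have hφ : Measurable fun (d : Finset.range q → ℤ) (k : ℕ) =>
        if hk : k ∈ Finset.range q then d ⟨k, hk⟩ else 0 :=
      measurable_pi_lambda _ fun k => by split_ifs <;> fun_prop
    have hψ : Measurable fun d : ({q} : Finset ℕ) → ℤ => d ⟨q, Finset.mem_singleton_self q⟩ := by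
      fun_prop
    convert h.comp hφ hψ using 1
    · funext ω k
      simp
    · rfl

lemma ae_eq_one_or_neg_one (hD : IsDirectionMechanism P lam N J₀ ε) (q : ℕ) :
    ∀ᵐ ω ∂P, ε q ω = 1 ∨ ε q ω = -1 := by
  have h1 : MeasurableSet {ω | ε q ω = 1} := hD.measurable_turn q (measurableSet_singleton 1)
  have h2 : MeasurableSet {ω | ε q ω = -1} := hD.measurable_turn q (measurableSet_singleton (-1))
  have h : P ({ω | ε q ω = 1} ∪ {ω | ε q ω = -1}) = 1 := by
    rw [measure_union _ h2, hD.turn_left, hD.turn_right, ENNReal.add_halves]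
    rw [Set.disjoint_left]
    intro ω ha hb
    simp only [mem_ofPred_eq] at ha hb
    omega
  exact (prob_compl_eq_zero_iff (h1.union h2)).mpr h

lemma ae_mem_range_four (hD : IsDirectionMechanism P lam N J₀ ε) :
    ∀ᵐ ω ∂P, J₀ ω ∈ ({0, 1, 2, 3} : Finset ℤ) := by
  have hm : ∀ j : Fin 4, MeasurableSet {ω | J₀ ω = ((j : ℕ) : ℤ)} := fun j =>
    hD.measurable_init (measurableSet_singleton _)
  have h : P (⋃ j : Fin 4, {ω | J₀ ω = ((j : ℕ) : ℤ)}) = 1 := by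
    rw [measure_iUnion _ hm, tsum_fintype]
    · simp only [hD.init_law]
      simp [ENNReal.mul_inv_cancel]
    · intro i j hij
      rw [Function.onFun, Set.disjoint_left]
      intro ω ha hb
      simp only [mem_ofPred_eq] at ha hb
      rw [ha] at hb
      exact hij (Fin.ext (by exact_mod_cast hb))
  filter_upwards [(prob_compl_eq_zero_iff (MeasurableSet.iUnion hm)).mpr h] with ω hω
  obtain ⟨j, hj⟩ := mem_iUnion.mp hω
  simp only [mem_ofPred_eq] at hj
  rw [hj]
  fin_cases j <;> simp

lemma integral_comp_init (hD : IsDirectionMechanism P lam N J₀ ε) (χ : ℤ → ℂ) :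
    ∫ ω, χ (J₀ ω) ∂P = (χ 0 + χ 1 + χ 2 + χ 3) / 4 := by
  have hsplit : ∀ᵐ ω ∂P, χ (J₀ ω) = ∑ j : Fin 4,
      (if J₀ ω = ((j : ℕ) : ℤ) then 1 else 0 : ℂ) * χ ((j : ℕ) : ℤ) := by
    filter_upwards [ae_mem_range_four hD] with ω hω
    simp only [Finset.mem_insert, Finset.mem_singleton] at hω
    rcases hω with h | h | h | h <;> simp [h, Fin.sum_univ_four]
  have hint : ∀ c : ℤ, Integrable (fun ω => (if J₀ ω = c then 1 else 0 : ℂ)) P := fun c =>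
    Integrable.of_bound ((measurable_of_countable
      fun j : ℤ => (if j = c then 1 else 0 : ℂ)).comp hD.measurable_init).aestronglyMeasurable 1
      (Eventually.of_forall fun ω => by split_ifs <;> simp)
  rw [integral_congr_ae hsplit, integral_finsetSum _ fun j _ => (hint _).mul_const _]
  simp only [integral_mul_const, integral_ite_eq hD.measurable_init, measureReal_def, hD.init_law]
  simp [Fin.sum_univ_four]
  ring

/-- One more turn multiplies the expectation of an eigenfunction of the direction chain by its
eigenvalue. -/
lemma integral_dirSum_succ (hD : IsDirectionMechanism P lam N J₀ ε) {χ : ℤ → ℂ} {r C : ℝ}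
    (hχ : ∀ j, χ (j + 1) + χ (j - 1) = 2 * r * χ j) (hχC : ∀ j, ‖χ j‖ ≤ C) {q : ℕ}
    {F : ℤ × (ℕ → ℤ) → ℂ} (hF : Measurable F) {C' : ℝ} (hFC : ∀ p, ‖F p‖ ≤ C')
    (hFq : ∀ p, F (truncTurns q p) = F p) :
    ∫ ω, χ (dirSum (J₀ ω, fun k => ε k ω) (q + 1)) * F (J₀ ω, fun k => ε k ω) ∂P =
      r * ∫ ω, χ (dirSum (J₀ ω, fun k => ε k ω) q) * F (J₀ ω, fun k => ε k ω) ∂P := by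
  set E : Ω → ℤ × (ℕ → ℤ) := fun ω => (J₀ ω, fun k => ε k ω) with hE
  have hEm : Measurable E := hD.measurable_pair
  have hHm : ∀ c : ℤ, Measurable fun p => χ (dirSum p q + c) * F p := fun c =>
    ((measurable_of_countable fun j : ℤ => χ (j + c)).comp (measurable_dirSum q)).mul hF
  have hHi : ∀ c : ℤ, Integrable (fun ω => χ (dirSum (E ω) q + c) * F (E ω)) P := fun c =>
    Integrable.of_bound ((hHm c).comp hEm).aestronglyMeasurable (C * C')
      (Eventually.of_forall fun ω => by
        rw [norm_mul]
        exact mul_le_mul (hχC _) (hFC _) (norm_nonneg _) ((norm_nonneg _).trans (hχC 0)))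
  have him : ∀ c : ℤ, Measurable fun ω => (if ε q ω = c then 1 else 0 : ℂ) := fun c =>
    (measurable_of_countable fun j : ℤ => (if j = c then 1 else 0 : ℂ)).comp (hD.measurable_turn q)
  have hprod : ∀ c : ℤ, P.real {ω | ε q ω = c} = 1 / 2 →
      ∫ ω, (if ε q ω = c then 1 else 0 : ℂ) * (χ (dirSum (E ω) q + c) * F (E ω)) ∂P =
        1 / 2 * ∫ ω, χ (dirSum (E ω) q + c) * F (E ω) ∂P := by
    intro c hc
    have h := (hD.indepFun_truncTurns q).symm.integral_fun_comp_mul_comp (𝕜 := ℂ)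
      (f := fun j : ℤ => (if j = c then 1 else 0 : ℂ)) (g := fun p => χ (dirSum p q + c) * F p)
      (hD.measurable_turn q).aemeasurable ((measurable_truncTurns q).comp hEm).aemeasurable
      (measurable_of_countable _).aestronglyMeasurable (hHm c).aestronglyMeasurable
    simp only [dirSum_truncTurns le_rfl, hFq] at h
    rw [h, integral_ite_eq (hD.measurable_turn q), hc]
    norm_num [hE]
  -- Conditioning on the value of the turn: each indicator is independent of the past and has mean
  -- 1/2, and the two branches recombine by the eigenfunction relation.
  have hsplit : ∀ᵐ ω ∂P, χ (dirSum (E ω) (q + 1)) * F (E ω) =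
      (if ε q ω = 1 then 1 else 0 : ℂ) * (χ (dirSum (E ω) q + 1) * F (E ω)) +
      (if ε q ω = -1 then 1 else 0 : ℂ) * (χ (dirSum (E ω) q + -1) * F (E ω)) := by
    filter_upwards [ae_eq_one_or_neg_one hD q] with ω hω
    have h : dirSum (E ω) (q + 1) = dirSum (E ω) q + ε q ω := dirSum_succ _ _
    rcases hω with h1 | h1 <;> simp [h, h1]
  have hii : ∀ c : ℤ, Integrable (fun ω => (if ε q ω = c then 1 else 0 : ℂ) *
      (χ (dirSum (E ω) q + c) * F (E ω))) P := fun c =>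
    (hHi c).bdd_mul (him c).aestronglyMeasurable (c := 1)
      (Eventually.of_forall fun ω => by split_ifs <;> simp)
  rw [integral_congr_ae hsplit, integral_add (hii 1) (hii (-1)),
    hprod 1 (by rw [measureReal_def, hD.turn_left]; simp),
    hprod (-1) (by rw [measureReal_def, hD.turn_right]; simp), ← mul_add,
    ← integral_add (hHi 1) (hHi (-1)), ← integral_const_mul, ← integral_const_mul]
  refine integral_congr_ae (Eventually.of_forall fun ω => ?_)
  have := hχ (dirSum (E ω) q)
  simp only
  rw [← add_mul, ← sub_eq_add_neg, this]
  ring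

lemma integral_dirSum_add (hD : IsDirectionMechanism P lam N J₀ ε) {χ : ℤ → ℂ} {r C : ℝ}
    (hχ : ∀ j, χ (j + 1) + χ (j - 1) = 2 * r * χ j) (hχC : ∀ j, ‖χ j‖ ≤ C) {q : ℕ}
    {F : ℤ × (ℕ → ℤ) → ℂ} (hF : Measurable F) {C' : ℝ} (hFC : ∀ p, ‖F p‖ ≤ C')
    (hFq : ∀ q', q ≤ q' → ∀ p, F (truncTurns q' p) = F p) (m : ℕ) :
    ∫ ω, χ (dirSum (J₀ ω, fun k => ε k ω) (q + m)) * F (J₀ ω, fun k => ε k ω) ∂P =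
      r ^ m * ∫ ω, χ (dirSum (J₀ ω, fun k => ε k ω) q) * F (J₀ ω, fun k => ε k ω) ∂P := by
  induction m with
  | zero => simp
  | succ m ih =>
    rw [← add_assoc, integral_dirSum_succ hD hχ hχC hF hFC (hFq _ (Nat.le_add_right _ _)), ih,
      pow_succ]
    ring

/-- The generating function of the Poisson law turns the eigenvalue r of one turn into the damping
factor over a time interval. -/
lemma integral_pow_poissonMeasure (mu : ℝ≥0) (r : ℝ) :
    ∫ n, ((r : ℂ) ^ n) ∂(poissonMeasure mu) = Real.exp (mu * (r - 1)) := by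
  rw [integral_poissonMeasure]
  have : ∀ n : ℕ, (Real.exp (-mu) * (mu : ℝ) ^ n / (n.factorial : ℝ)) • ((r : ℂ) ^ n) =
      (Real.exp (-mu) : ℂ) * (((mu * r) ^ n / (n.factorial : ℝ) : ℝ) : ℂ) := by
    intro n
    rw [Complex.real_smul]
    push_cast
    rw [mul_pow]
    ring
  simp only [this]
  rw [tsum_mul_left, ← Complex.ofReal_tsum]
  have h := (NormedSpace.expSeries_div_hasSum_exp (𝔸 := ℝ) ((mu : ℝ) * r)).tsum_eq
  rw [h, ← Real.exp_eq_exp_ℝ, ← Complex.ofReal_mul, ← Real.exp_add]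
  congr 2
  ring

end Turns

/-! ### The walk observed on a time grid -/

/-- The product of `w` over the directions after `n 1, …, n k` turns. -/
noncomputable def walkProd (w : ℤ → ℂ) (k : ℕ) (n : ℕ → ℕ) (p : ℤ × (ℕ → ℤ)) : ℂ :=
  ∏ i ∈ Finset.range k, w (dirSum p (n (i + 1)))

lemma measurable_comp_dirSum_apply (χ : ℤ → ℂ) (i : ℕ) :
    Measurable fun z : (ℕ → ℕ) × (ℤ × (ℕ → ℤ)) => χ (dirSum z.2 (z.1 i)) := by
  have h : Measurable fun z : (ℕ → ℕ) × (ℤ × (ℕ → ℤ)) => (z.1 i, z.2) := by fun_prop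
  exact (measurable_of_countable χ).comp (measurable_dirSum_uncurry.comp h)

lemma measurable_walkProd (w : ℤ → ℂ) (k : ℕ) :
    Measurable fun z : (ℕ → ℕ) × (ℤ × (ℕ → ℤ)) => walkProd w k z.1 z.2 :=
  Finset.measurable_fun_prod _ fun i _ => measurable_comp_dirSum_apply w (i + 1)

lemma norm_walkProd_le {w : ℤ → ℂ} (hw : ∀ j, ‖w j‖ ≤ 1) (k : ℕ) (n : ℕ → ℕ)
    (p : ℤ × (ℕ → ℤ)) : ‖walkProd w k n p‖ ≤ 1 := by
  rw [walkProd, norm_prod]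
  exact Finset.prod_le_one (fun _ _ => norm_nonneg _) fun _ _ => hw _

lemma walkProd_congr (w : ℤ → ℂ) {k : ℕ} {n n' : ℕ → ℕ} (h : ∀ i ≤ k, n i = n' i)
    (p : ℤ × (ℕ → ℤ)) : walkProd w k n p = walkProd w k n' p :=
  Finset.prod_congr rfl fun i hi => by rw [h (i + 1) (by have := Finset.mem_range.mp hi; omega)]

section

variable {Ω : Type*} [MeasurableSpace Ω] {P : Measure Ω} {lam : ℝ≥0} {N : ℝ≥0 → Ω → ℕ}

/-- The counts up to time t k are sums of earlier increments. Truncated subtraction is harmless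
because almost every path is nondecreasing and starts at 0. -/
lemma IsPoissonProcess.indepFun_past (hN : IsPoissonProcess P lam N) {t : ℕ → ℝ≥0}
    (ht : Monotone t) (ht0 : t 0 = 0) (k : ℕ) :
    IndepFun (fun ω (i : Fin (k + 1)) => N (t i) ω) (fun ω => N (t (k + 1)) ω - N (t k) ω) P := by
  have hI := hN.indep.nat ht
  have hm : ∀ i, Measurable fun ω => N (t (i + 1)) ω - N (t i) ω := fun i =>
    (hN.measurable _).sub (hN.measurable _)
  have h := hI.indepFun_finset (Finset.range k) {k} (by simp) hm
  have hφ : Measurable fun (d : Finset.range k → ℕ) (i : Fin (k + 1)) =>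
      ∑ l ∈ Finset.range i, if hl : l ∈ Finset.range k then d ⟨l, hl⟩ else 0 :=
    measurable_pi_lambda _ fun i => Finset.measurable_fun_sum _ fun l _ => by
      split_ifs <;> fun_prop
  have hψ : Measurable fun d : ({k} : Finset ℕ) → ℕ => d ⟨k, Finset.mem_singleton_self k⟩ := by
    fun_prop
  refine (h.comp hφ hψ).congr ?_ (Eventually.of_forall fun ω => rfl)
  filter_upwards [hN.zero, hN.mono] with ω h0 hmono
  funext i
  have hsum : ∀ i : ℕ, i ≤ k → ∑ l ∈ Finset.range i, (if hl : l ∈ Finset.range k then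
      N (t (l + 1)) ω - N (t l) ω else 0) = N (t i) ω := by
    intro i
    induction i with
    | zero => simp [ht0, h0]
    | succ i ih =>
      intro hi
      rw [Finset.sum_range_succ, ih (by omega), dif_pos (Finset.mem_range.mpr (by omega))]
      have : N (t i) ω ≤ N (t (i + 1)) ω := hmono (ht (Nat.le_succ i))
      omega
  exact hsum i (by omega)

variable {J₀ : Ω → ℤ} {ε : ℕ → Ω → ℤ} [IsProbabilityMeasure P]

/-- The Markov property of the direction chain tested on an eigenfunction: between the times
`t k` and `t (k + 1)` the expectation is damped by an exponential factor. -/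
lemma integral_dirSum_poisson_succ (hD : IsDirectionMechanism P lam N J₀ ε) {χ : ℤ → ℂ} {r C : ℝ}
    (hχ : ∀ j, χ (j + 1) + χ (j - 1) = 2 * r * χ j) (hχC : ∀ j, ‖χ j‖ ≤ C)
    {w : ℤ → ℂ} (hw : ∀ j, ‖w j‖ ≤ 1) {t : ℕ → ℝ≥0} (ht : Monotone t) (ht0 : t 0 = 0) (k : ℕ) :
    ∫ ω, χ (dirSum (J₀ ω, fun i => ε i ω) (N (t (k + 1)) ω)) *
        walkProd w k (fun i => N (t i) ω) (J₀ ω, fun i => ε i ω) ∂P =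
      Real.exp (lam * (t (k + 1) - t k) * (r - 1)) *
        ∫ ω, χ (dirSum (J₀ ω, fun i => ε i ω) (N (t k) ω)) *
          walkProd w k (fun i => N (t i) ω) (J₀ ω, fun i => ε i ω) ∂P := by
  set E : Ω → ℤ × (ℕ → ℤ) := fun ω => (J₀ ω, fun k => ε k ω) with hE
  set X : Ω → ℕ → ℕ := fun ω i => N (t i) ω with hX
  have hC0 : 0 ≤ C := (norm_nonneg _).trans (hχC 0)
  have hEm : Measurable E := hD.measurable_pair
  have hXm : Measurable X := measurable_pi_lambda _ fun i => hD.poisson.measurable _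
  have hXE : IndepFun X E P := hD.indep_poisson.comp (φ := fun ν i => ν (t i))
    (measurable_pi_lambda _ fun i => measurable_pi_apply _) measurable_id
  have hbound : ∀ i n p, ‖χ (dirSum p (n i)) * walkProd w k n p‖ ≤ C := fun i n p => by
    rw [norm_mul]
    calc _ ≤ C * 1 := mul_le_mul (hχC _) (norm_walkProd_le hw k n p) (norm_nonneg _) hC0
      _ = C := mul_one C
  have hmeas : ∀ i, Measurable fun z : (ℕ → ℕ) × (ℤ × (ℕ → ℤ)) =>
      χ (dirSum z.2 (z.1 i)) * walkProd w k z.1 z.2 := fun i =>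
    (measurable_comp_dirSum_apply χ i).mul (measurable_walkProd w k)
  set Ψ : (ℕ → ℕ) → ℂ := fun n => ∫ ω, χ (dirSum (E ω) (n k)) * walkProd w k n (E ω) ∂P with hΨ
  have h1 := integral_eq_integral_integral_of_indepFun hXm hEm hXE
    (F := fun n p => χ (dirSum p (n (k + 1))) * walkProd w k n p) (hmeas (k + 1)) (hbound (k + 1))
  have h2 := integral_eq_integral_integral_of_indepFun hXm hEm hXE
    (F := fun n p => χ (dirSum p (n k)) * walkProd w k n p) (hmeas k) (hbound k)
  -- With the counts frozen, the product over past directions involves only the first N(t k) turns,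
  -- so each further turn contributes a factor r.
  have hinner : ∀ᵐ ω ∂P, ∫ ω', χ (dirSum (E ω') (X ω (k + 1))) * walkProd w k (X ω) (E ω') ∂P =
      (r : ℂ) ^ (N (t (k + 1)) ω - N (t k) ω) * Ψ (X ω) := by
    filter_upwards [hD.poisson.mono] with ω hmono
    have hmon : Monotone (X ω) := fun i j hij => hmono (ht hij)
    have hk : X ω (k + 1) = X ω k + (N (t (k + 1)) ω - N (t k) ω) := by
      have : N (t k) ω ≤ N (t (k + 1)) ω := hmon (Nat.le_succ k)
      simp only [hX]
      omega
    rw [hk]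
    have hFm : Measurable (walkProd w k (X ω)) :=
      (measurable_walkProd w k).comp (measurable_prodMk_left (x := X ω))
    refine integral_dirSum_add hD hχ hχC (q := X ω k) (F := walkProd w k (X ω)) hFm
      (norm_walkProd_le hw k (X ω)) (fun q hq p => ?_) (N (t (k + 1)) ω - N (t k) ω)
    refine Finset.prod_congr rfl fun i hi => ?_
    rw [dirSum_truncTurns]
    exact (hmon (by have := Finset.mem_range.mp hi; omega)).trans hq
  -- Ψ depends only on the first k + 1 counts. Passing to `Fin (k + 1) → ℕ`, which is countable,
  -- makes measurability automatic and allows the use of `indepFun_past`.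
  have hext : ∀ n : ℕ → ℕ, Ψ n = Ψ (fun i => if h : i < k + 1 then
      (fun j : Fin (k + 1) => n j) ⟨i, h⟩ else 0) := by
    intro n
    simp only [hΨ]
    refine integral_congr_ae (Eventually.of_forall fun ω => ?_)
    simp only
    rw [dif_pos (Nat.lt_succ_self k), walkProd_congr]
    intro i hi
    rw [dif_pos (by omega)]
  have hind := (hD.poisson.indepFun_past ht ht0 k).symm.integral_fun_comp_mul_comp (𝕜 := ℂ)
    (f := fun m : ℕ => (r : ℂ) ^ m)
    (g := fun v : Fin (k + 1) → ℕ => Ψ (fun i => if h : i < k + 1 then v ⟨i, h⟩ else 0))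
    ((hD.poisson.measurable _).sub (hD.poisson.measurable _)).aemeasurable
    (measurable_pi_lambda _ fun i => hD.poisson.measurable _).aemeasurable
    (measurable_of_countable _).aestronglyMeasurable
    (measurable_of_countable _).aestronglyMeasurable
  have hpgf : ∫ ω, (r : ℂ) ^ (N (t (k + 1)) ω - N (t k) ω) ∂P =
      Real.exp (lam * (t (k + 1) - t k) * (r - 1)) := by
    have h := (hD.poisson.law (t k) (t (k + 1)) (ht (Nat.le_succ k))).integral_comp
      (f := fun n : ℕ => (r : ℂ) ^ n) (measurable_of_countable _).aestronglyMeasurable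
    have h' : ∫ ω, (r : ℂ) ^ (N (t (k + 1)) ω - N (t k) ω) ∂P =
      ∫ n, (r : ℂ) ^ n ∂(poissonMeasure (lam * (t (k + 1) - t k))) := h
    rw [h', integral_pow_poissonMeasure]
    rw [NNReal.coe_mul, NNReal.coe_sub (ht (Nat.le_succ k))]
  rw [h1, h2, integral_congr_ae hinner]
  have h3 : ∀ ω, Ψ (X ω) = (fun v : Fin (k + 1) → ℕ => Ψ (fun i => if h : i < k + 1 then v ⟨i, h⟩
      else 0)) (fun i : Fin (k + 1) => N (t i) ω) := fun ω => hext (X ω)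
  calc _ = ∫ ω, (r : ℂ) ^ (N (t (k + 1)) ω - N (t k) ω) *
        (fun v : Fin (k + 1) → ℕ => Ψ (fun i => if h : i < k + 1 then v ⟨i, h⟩
          else 0)) (fun i : Fin (k + 1) => N (t i) ω) ∂P := by simp only [h3]
    _ = _ := by
      rw [hind, hpgf]
      congr 1
      exact integral_congr_ae (Eventually.of_forall fun ω => (h3 ω).symm)

lemma cexp_mul_sign {s : ℝ} (hs : |s| = 1) (x : ℝ) :
    Complex.exp ((x * s : ℝ) * Complex.I) = Real.cos x + Complex.I * Real.sin x * s := by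
  rcases (abs_eq zero_le_one).mp hs with rfl | rfl
  · rw [mul_one, Complex.exp_mul_I, Complex.ofReal_cos, Complex.ofReal_sin]
    push_cast
    ring
  · rw [Complex.exp_mul_I, ← Complex.ofReal_cos, ← Complex.ofReal_sin, mul_neg_one, Real.cos_neg,
      Real.sin_neg]
    push_cast
    ring

/-- The factor contributed by a time step of length `h` in direction `j`. -/
noncomputable def stepPhase (xi eta h : ℝ) (j : ℤ) : ℂ :=
  Complex.exp ((h * (xi * sumSign j + eta * diffSign j) : ℝ) * Complex.I)

lemma stepPhase_eq (xi eta h : ℝ) (j : ℤ) : stepPhase xi eta h j =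
    (Real.cos (h * xi) + Complex.I * Real.sin (h * xi) * sumSign j) *
      (Real.cos (h * eta) + Complex.I * Real.sin (h * eta) * diffSign j) := by
  rw [← cexp_mul_sign (abs_sumSign j), ← cexp_mul_sign (abs_diffSign j), ← Complex.exp_add,
    stepPhase]
  congr 1
  push_cast
  ring

lemma norm_stepPhase (xi eta h : ℝ) (j : ℤ) : ‖stepPhase xi eta h j‖ = 1 :=
  Complex.norm_exp_ofReal_mul_I _

lemma splitStep_re_im (lam xi h : ℝ) (u : ℂ) :
    (splitStep lam xi h u).re =
        Real.cos (h * xi) * u.re - Real.sin (h * xi) * (Real.exp (-lam * h) * u.im) ∧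
      (splitStep lam xi h u).im =
        Real.sin (h * xi) * u.re + Real.cos (h * xi) * (Real.exp (-lam * h) * u.im) := by
  have h1 : splitStep lam xi h u = (⟨Real.cos (h * xi), Real.sin (h * xi)⟩ : ℂ) *
      ⟨u.re, Real.exp (-lam * h) * u.im⟩ := by
    rw [splitStep, ← Complex.ofReal_mul, Complex.exp_mul_I, ← Complex.ofReal_cos,
      ← Complex.ofReal_sin, Complex.mk_eq_add_mul_I, Complex.mk_eq_add_mul_I]
    ring
  rw [h1]
  simp only [Complex.mul_re, Complex.mul_im]
  exact ⟨trivial, by ring⟩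

/-- The joint characteristic function of the discretised motion factorises into two splitting
schemes; the companion identities carry the signs of the two velocities. -/
lemma integral_walkProd (hD : IsDirectionMechanism P lam N J₀ ε) (xi eta : ℝ) (h : ℝ≥0) (k : ℕ) :
    let u := (splitStep lam xi h)^[k] 1
    let u' := (splitStep lam eta h)^[k] 1
    let I := fun χ : ℤ → ℂ => ∫ ω, χ (dirSum (J₀ ω, fun i => ε i ω) (N (k * h) ω)) *
      walkProd (stepPhase xi eta h) k (fun i => N (i * h) ω) (J₀ ω, fun i => ε i ω) ∂P
    I (fun _ => 1) = u.re * u'.re ∧ I (fun j => sumSign j) = Complex.I * u.im * u'.re ∧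
      I (fun j => diffSign j) = Complex.I * u.re * u'.im ∧
      I (fun j => sumSign j * diffSign j) = -(u.im * u'.im) := by
  induction k with
  | zero =>
    -- At time 0 the direction is uniform on the four values, over which s, d and sd average to 0.
    have hcongr : ∀ χ : ℤ → ℂ, ∫ ω, χ (dirSum (J₀ ω, fun i => ε i ω) (N ((0 : ℕ) * h) ω)) *
        walkProd (stepPhase xi eta h) 0 (fun i => N (i * h) ω) (J₀ ω, fun i => ε i ω) ∂P =
        (χ 0 + χ 1 + χ 2 + χ 3) / 4 := by
      intro χ
      rw [← integral_comp_init hD]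
      refine integral_congr_ae ?_
      filter_upwards [hD.poisson.zero] with ω hω
      simp [walkProd, dirSum, hω]
    have e1 : sumSign 1 = 1 ∧ diffSign 1 = -1 := by
      have := sumSign_add_one 0
      have := diffSign_add_one 0
      simp_all [sumSign_diffSign_zero]
    have e2 : sumSign 2 = -1 ∧ diffSign 2 = -1 := by
      have h1 := sumSign_add_one 1
      have h2 := diffSign_add_one 1
      rw [e1.1] at h2
      rw [e1.2] at h1
      exact ⟨h1, h2⟩
    have e3 : sumSign 3 = -1 ∧ diffSign 3 = 1 := by
      have h1 := sumSign_add_one 2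
      have h2 := diffSign_add_one 2
      rw [e2.1, neg_neg] at h2
      rw [e2.2] at h1
      exact ⟨h1, h2⟩
    have c1 := hcongr fun _ => 1
    have c2 := hcongr fun j => sumSign j
    have c3 := hcongr fun j => diffSign j
    have c4 := hcongr fun j => sumSign j * diffSign j
    dsimp only at c1 c2 c3 c4 ⊢
    rw [c1, c2, c3, c4, sumSign_diffSign_zero.1, sumSign_diffSign_zero.2, e1.1, e1.2, e2.1, e2.2,
      e3.1, e3.2]
    norm_num
  | succ k ih =>
    obtain ⟨i1, i2, i3, i4⟩ := ih
    dsimp only at i1 i2 i3 i4 ⊢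
    have ht : Monotone fun i : ℕ => (i : ℝ≥0) * h := fun i j hij => by
      have : (i : ℝ≥0) ≤ j := by exact_mod_cast hij
      simp only
      gcongr
    have hw : ∀ j, ‖stepPhase xi eta h j‖ ≤ 1 := fun j => (norm_stepPhase xi eta h j).le
    have hdt : (((k + 1 : ℕ) : ℝ≥0) * h : ℝ≥0) - ((k : ℝ≥0) * h : ℝ≥0) = (h : ℝ) := by
      push_cast
      ring
    have hs : ∀ j, ‖(sumSign j : ℂ)‖ ≤ 1 := fun j => by
      rw [Complex.norm_real, Real.norm_eq_abs, abs_sumSign]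
    have hd : ∀ j, ‖(diffSign j : ℂ)‖ ≤ 1 := fun j => by
      rw [Complex.norm_real, Real.norm_eq_abs, abs_diffSign]
    have hsd : ∀ j, ‖(sumSign j * diffSign j : ℂ)‖ ≤ 1 := fun j => by
      rw [norm_mul]
      exact mul_le_one₀ (hs j) (norm_nonneg _) (hd j)
    -- The two neighbours of a direction have opposite values of s, and likewise of d (eigenvalue
    -- 0); the product sd changes sign at every turn (eigenvalue -1).
    have s2 := integral_dirSum_poisson_succ hD (χ := fun j => sumSign j) (r := 0) (C := 1)
      (fun j => by simp [sumSign_add_one, sumSign_sub_one]) hs hw ht (by simp) k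
    have s3 := integral_dirSum_poisson_succ hD (χ := fun j => diffSign j) (r := 0) (C := 1)
      (fun j => by simp [diffSign_add_one, diffSign_sub_one]) hd hw ht (by simp) k
    have s4 := integral_dirSum_poisson_succ hD (χ := fun j => sumSign j * diffSign j) (r := -1)
      (C := 1) (fun j => by
        simp [diffSign_add_one, diffSign_sub_one, sumSign_add_one, sumSign_sub_one]
        ring) hsd hw ht (by simp) k
    rw [i2, hdt, zero_sub, mul_neg_one, ← neg_mul] at s2
    rw [i3, hdt, zero_sub, mul_neg_one, ← neg_mul] at s3
    -- The eigenvalue -1 damps sd by e^{-2 lam h}, the product of the dampings of s and d; this is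
    -- what makes the factorisation exact.
    rw [i4, hdt, show (lam : ℝ) * h * (-1 - 1) = -lam * h + -lam * h by ring, Real.exp_add,
      Complex.ofReal_mul] at s4
    set W : Ω → ℂ := fun ω => walkProd (stepPhase xi eta h) k (fun i => N (i * h) ω)
      (J₀ ω, fun i => ε i ω) with hW
    set D : Ω → ℤ := fun ω => dirSum (J₀ ω, fun i => ε i ω) (N ((k + 1 : ℕ) * h) ω) with hDdef
    have hpair := hD.measurable_pair
    have hDm : Measurable D := measurable_dirSum_uncurry.comp
      ((hD.poisson.measurable _).prodMk hpair)
    have hWm : Measurable W := (measurable_walkProd _ k).comp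
      ((measurable_pi_lambda (fun ω (i : ℕ) => N (i * h) ω)
        fun i => hD.poisson.measurable _).prodMk hpair)
    have hint : ∀ χ : ℤ → ℂ, (∀ j, ‖χ j‖ ≤ 1) → Integrable (fun ω => χ (D ω) * W ω) P := by
      intro χ hχ
      refine Integrable.of_bound
        (((measurable_of_countable χ).comp hDm).mul hWm).aestronglyMeasurable 1
        (Eventually.of_forall fun ω => ?_)
      rw [norm_mul]
      exact mul_le_one₀ (hχ _) (norm_nonneg _) (norm_walkProd_le hw _ _ _)
    -- The phase of the new step multiplies χ inside the span of 1, s, d, sd, so the four new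
    -- expectations are linear combinations of the four damped ones.
    have hlin : ∀ (χ : ℤ → ℂ) (c0 c1 c2 c3 : ℂ), (∀ j, χ j * stepPhase xi eta h j =
        c0 * 1 + c1 * sumSign j + c2 * diffSign j + c3 * (sumSign j * diffSign j)) →
        ∫ ω, χ (D ω) * walkProd (stepPhase xi eta h) (k + 1) (fun i => N (i * h) ω)
          (J₀ ω, fun i => ε i ω) ∂P =
        c0 * (∫ ω, 1 * W ω ∂P) + c1 * (∫ ω, sumSign (D ω) * W ω ∂P) +
          c2 * (∫ ω, diffSign (D ω) * W ω ∂P) +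
          c3 * ∫ ω, sumSign (D ω) * diffSign (D ω) * W ω ∂P := by
      intro χ c0 c1 c2 c3 hχ
      have e : ∀ ω, χ (D ω) * walkProd (stepPhase xi eta h) (k + 1) (fun i => N (i * h) ω)
          (J₀ ω, fun i => ε i ω) = c0 * (1 * W ω) + c1 * (sumSign (D ω) * W ω) +
          c2 * (diffSign (D ω) * W ω) + c3 * (sumSign (D ω) * diffSign (D ω) * W ω) := by
        intro ω
        rw [walkProd, Finset.prod_range_succ]
        calc _ = (χ (D ω) * stepPhase xi eta h (D ω)) * W ω := by
              simp only [hW, walkProd, hDdef]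
              ring
          _ = _ := by
              rw [hχ]
              ring
      simp only [e]
      have a1 := (hint (fun _ => 1) (by simp)).const_mul c0
      have a2 := (hint (fun j => sumSign j) hs).const_mul c1
      have a3 := (hint (fun j => diffSign j) hd).const_mul c2
      have a4 := (hint (fun j => sumSign j * diffSign j) hsd).const_mul c3
      have a12 : Integrable (fun ω => c0 * (1 * W ω) + c1 * (sumSign (D ω) * W ω)) P := a1.add a2
      have a123 : Integrable (fun ω => c0 * (1 * W ω) + c1 * (sumSign (D ω) * W ω) +
        c2 * (diffSign (D ω) * W ω)) P := a12.add a3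
      rw [integral_add a123 a4, integral_add a12 a3, integral_add a1 a2]
      simp only [integral_const_mul]
    have hsq : ∀ j, (sumSign j : ℂ) ^ 2 = 1 ∧ (diffSign j : ℂ) ^ 2 = 1 := fun j => by
      constructor
      · exact_mod_cast (sumSign_diffSign_sq j).1
      · exact_mod_cast (sumSign_diffSign_sq j).2
    simp only [Function.iterate_succ_apply', splitStep_re_im]
    generalize (splitStep lam xi h)^[k] 1 = u at *
    generalize (splitStep lam eta h)^[k] 1 = u' at *
    generalize Real.exp (-lam * h) = d at *
    have hII := Complex.I_mul_I
    set I := Complex.I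
    obtain ⟨c, hc⟩ : ∃ c, c = Real.cos (h * xi) := ⟨_, rfl⟩
    obtain ⟨s, hs'⟩ : ∃ s, s = Real.sin (h * xi) := ⟨_, rfl⟩
    obtain ⟨c', hc'⟩ : ∃ c, c = Real.cos (h * eta) := ⟨_, rfl⟩
    obtain ⟨s', hs''⟩ : ∃ s, s = Real.sin (h * eta) := ⟨_, rfl⟩
    have hph : ∀ j, stepPhase xi eta h j =
        (c + I * s * sumSign j) * (c' + I * s' * diffSign j) := fun j => by
      rw [stepPhase_eq, hc, hs', hc', hs'']
    rw [← hc, ← hs', ← hc', ← hs'']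
    refine ⟨?_, ?_, ?_, ?_⟩
    · rw [hlin (fun _ => 1) (c * c') (I * s * c') (c * I * s') (I * s * I * s')
        (fun j => by rw [hph]; ring), i1, s2, s3, s4]
      push_cast
      linear_combination
        (s * c' * d * u.im * u'.re + c * s' * d * u.re * u'.im -
          s * s' * d ^ 2 * u.im * u'.im : ℂ) * hII
    · rw [hlin (fun j => sumSign j) (I * s * c') (c * c') (I * s * I * s') (c * I * s')
        (fun j => by
          rw [hph]
          linear_combination (I * s * (c' + I * s' * diffSign j)) * (hsq j).1), i1, s2, s3, s4]
      push_cast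
      linear_combination (I * s * s' * u.re * d * u'.im) * hII
    · rw [hlin (fun j => diffSign j) (c * I * s') (I * s * I * s') (c * c') (I * s * c')
        (fun j => by
          rw [hph]
          linear_combination (I * s' * (c + I * s * sumSign j)) * (hsq j).2), i1, s2, s3, s4]
      push_cast
      linear_combination (I * s * s' * u.im * d * u'.re) * hII
    · rw [hlin (fun j => sumSign j * diffSign j) (I * s * I * s') (c * I * s') (I * s * c') (c * c')
        (fun j => by
          rw [hph]
          linear_combination (I * s * diffSign j * (c' + I * s' * diffSign j)) * (hsq j).1 +
            (I * s' * (c * sumSign j + I * s)) * (hsq j).2), i1, s2, s3, s4]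
      push_cast
      linear_combination
        (s * s' * u.re * u'.re + c * s' * d * u.im * u'.re + s * c' * d * u.re * u'.im : ℂ) * hII

end

/-! ### From the time grid to continuous time -/

/-- Right Riemann sums of a bounded right-continuous function converge to its integral. -/
lemma tendsto_right_riemann_sum {g : ℝ → ℝ} {M t : ℝ} (ht : 0 < t) (hM : ∀ r, |g r| ≤ M)
    (hg : ∀ r, ContinuousWithinAt g (Ici r) r) :
    Tendsto (fun n : ℕ => ∑ i ∈ Finset.range n, t / n * g ((i + 1 : ℕ) * (t / n))) atTop
      (𝓝 (∫ r in (0 : ℝ)..t, g r)) := by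
  -- The sum is the integral of g at r rounded up to the grid. Rounding up approaches r from the
  -- right, so right-continuity suffices.
  set a : ℕ → ℝ → ℝ := fun n r => (⌈r / (t / n)⌉₊ : ℝ) * (t / n) with ha
  have hsum : ∀ᶠ n : ℕ in atTop, ∑ i ∈ Finset.range n, t / n * g ((i + 1 : ℕ) * (t / n)) =
      ∫ r in (0 : ℝ)..t, g (a n r) := by
    filter_upwards [eventually_gt_atTop 0] with n hn
    have hn' : (0 : ℝ) < n := by exact_mod_cast hn
    have hh : 0 < t / n := by positivity
    have hpiece : ∀ i : ℕ, ∀ r ∈ uIoc ((i : ℝ) * (t / n)) ((i + 1 : ℕ) * (t / n)),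
        g (a n r) = g ((i + 1 : ℕ) * (t / n)) := by
      intro i r hr
      rw [uIoc_of_le (by push_cast; nlinarith)] at hr
      have h1 : ⌈r / (t / n)⌉₊ = i + 1 := by
        rw [Nat.ceil_eq_iff (Nat.succ_ne_zero i)]
        rw [Nat.succ_sub_one]
        exact ⟨(lt_div_iff₀ hh).mpr hr.1, (div_le_iff₀ hh).mpr hr.2⟩
      simp only [ha, h1]
    have hadj := intervalIntegral.sum_integral_adjacent_intervals (μ := volume)
      (f := fun r => g (a n r)) (a := fun i : ℕ => (i : ℝ) * (t / n)) (n := n) (fun i _ => by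
        refine (intervalIntegrable_const (c := g ((i + 1 : ℕ) * (t / n)))).congr ?_
        exact fun r hr => (hpiece i r hr).symm)
    simp only [Nat.cast_zero, zero_mul, mul_div_cancel₀ t hn'.ne'] at hadj
    rw [← hadj]
    refine Finset.sum_congr rfl fun i _ => ?_
    rw [intervalIntegral.integral_congr_ae (Eventually.of_forall (hpiece i))]
    rw [intervalIntegral.integral_const, smul_eq_mul]
    push_cast
    ring
  refine Tendsto.congr' (hsum.mono fun n hn => hn.symm) ?_
  refine intervalIntegral.tendsto_integral_filter_of_dominated_convergence (fun _ => M)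
    (Eventually.of_forall fun n => ?_) (Eventually.of_forall fun n => Eventually.of_forall
      fun r _ => hM _) intervalIntegrable_const (Eventually.of_forall fun r hr => ?_)
  · exact ((measurable_of_countable fun k : ℕ => g (k * (t / n))).comp
      (Nat.measurable_ceil.comp (measurable_id.div_const (t / n)))).aestronglyMeasurable
  · rw [uIoc_of_le ht.le] at hr
    refine (hg r).tendsto.comp (tendsto_nhdsWithin_iff.mpr ⟨?_, ?_⟩)
    · have hbound : ∀ᶠ n : ℕ in atTop, r ≤ a n r ∧ a n r ≤ r + t / n := by
        filter_upwards [eventually_gt_atTop 0] with n hn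
        have hn' : (0 : ℝ) < n := by exact_mod_cast hn
        have hh : 0 < t / n := by positivity
        refine ⟨(div_le_iff₀ hh).mp (Nat.le_ceil _), ?_⟩
        have := (Nat.ceil_lt_add_one (div_nonneg hr.1.le hh.le)).le
        calc a n r ≤ (r / (t / n) + 1) * (t / n) := mul_le_mul_of_nonneg_right this hh.le
          _ = r + t / n := by rw [add_mul, div_mul_cancel₀ _ hh.ne', one_mul]
      refine tendsto_of_tendsto_of_tendsto_of_le_of_le' tendsto_const_nhds ?_
        (hbound.mono fun n hn => hn.1) (hbound.mono fun n hn => hn.2)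
      simpa using (tendsto_const_div_atTop_nhds_zero_nat t).const_add r
    · filter_upwards [eventually_gt_atTop 0] with n hn
      have hn' : (0 : ℝ) < n := by exact_mod_cast hn
      exact (div_le_iff₀ (by positivity : 0 < t / n)).mp (Nat.le_ceil _)

section

variable {Ω : Type*} {N : ℝ≥0 → Ω → ℕ} {J₀ : Ω → ℤ} {ε : ℕ → Ω → ℤ}

lemma dirIndex_eq_dirSum (r : ℝ) (ω : Ω) : dirIndex N J₀ ε r ω =
    dirSum (J₀ ω, fun k => ε k ω) (N r.toNNReal ω) := rfl

lemma monotone_comp_toNNReal {ω : Ω} (h : Monotone fun t => N t ω) :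
    Monotone fun r : ℝ => N r.toNNReal ω :=
  fun _ _ hab => h (Real.toNNReal_mono hab)

lemma intervalIntegrable_comp_dirIndex {ω : Ω} (h : Monotone fun t => N t ω) (f : ℤ → ℝ) {M : ℝ}
    (hf : ∀ j, |f j| ≤ M) (a b : ℝ) :
    IntervalIntegrable (fun r => f (dirIndex N J₀ ε r ω)) volume a b := by
  have hm : Measurable fun r => f (dirIndex N J₀ ε r ω) :=
    (measurable_of_countable fun n : ℕ => f (dirSum (J₀ ω, fun k => ε k ω) n)).comp
      (monotone_comp_toNNReal h).measurable
  exact (intervalIntegrable_const (c := M)).mono_fun hm.aestronglyMeasurable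
    (Eventually.of_forall fun r => (hf _).trans (le_abs_self M))

lemma continuousWithinAt_comp_dirIndex {ω : Ω}
    (h : ∀ t, ContinuousWithinAt (fun s => N s ω) (Ici t) t) (f : ℤ → ℝ) (r : ℝ) :
    ContinuousWithinAt (fun r => f (dirIndex N J₀ ε r ω)) (Ici r) r := by
  have h1 : ContinuousWithinAt (fun r : ℝ => N r.toNNReal ω) (Ici r) r :=
    (h r.toNNReal).comp (t := Ici r.toNNReal) (f := Real.toNNReal)
      continuous_real_toNNReal.continuousWithinAt fun s hs => Real.toNNReal_mono hs
  have h2 : Continuous fun n : ℕ => f (dirSum (J₀ ω, fun k => ε k ω) n) :=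
    continuous_of_discreteTopology
  exact h2.continuousAt.comp_continuousWithinAt h1

variable [MeasurableSpace Ω] {P : Measure Ω} [IsProbabilityMeasure P] {lam : ℝ≥0}

/-- The joint characteristic function of the two integrated signs. -/
lemma integral_exp_integral_sign (hD : IsDirectionMechanism P lam N J₀ ε) {t : ℝ} (ht : 0 < t)
    (xi eta : ℝ) :
    ∫ ω, Complex.exp ((xi * (∫ r in (0 : ℝ)..t, sumSign (dirIndex N J₀ ε r ω)) +
        eta * (∫ r in (0 : ℝ)..t, diffSign (dirIndex N J₀ ε r ω)) : ℝ) * Complex.I) ∂P =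
      (telegraphSol lam xi t).re * (telegraphSol lam eta t).re := by
  have hpair := hD.measurable_pair
  set W : ℕ → Ω → ℂ := fun n ω => walkProd (stepPhase xi eta (t / n)) n
    (fun i => N (i * (t.toNNReal / n)) ω) (J₀ ω, fun i => ε i ω) with hW
  have hcast : ∀ n : ℕ, ((t.toNNReal / n : ℝ≥0) : ℝ) = t / n := fun n => by
    rw [NNReal.coe_div, Real.coe_toNNReal _ ht.le, NNReal.coe_natCast]
  have hint : ∀ n, ∫ ω, W n ω ∂P = (((splitStep lam xi (t / n))^[n] 1).re : ℂ) *
      ((splitStep lam eta (t / n))^[n] 1).re := by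
    intro n
    have := (integral_walkProd hD xi eta (t.toNNReal / n) n).1
    simp only [one_mul, hcast] at this
    exact this
  have hlim1 : Tendsto (fun n => ∫ ω, W n ω ∂P) atTop
      (𝓝 ((telegraphSol lam xi t).re * (telegraphSol lam eta t).re)) := by
    simp only [hint]
    have hsol : ∀ x : ℝ, Tendsto (fun n : ℕ => (((splitStep lam x (t / n))^[n] 1).re : ℂ)) atTop
        (𝓝 ((telegraphSol lam x t).re : ℂ)) := fun x => by
      have h := tendsto_iterate_splitStep lam.coe_nonneg (hasDerivAt_telegraphSol lam x) ht.le
      rw [telegraphSol_zero] at h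
      exact (Complex.continuous_ofReal.comp Complex.continuous_re).continuousAt.tendsto.comp h
    exact (hsol xi).mul (hsol eta)
  -- Pathwise, the walk product is the exponential of a right Riemann sum; being bounded by 1, its
  -- expectations converge to that of the exponential of the integral.
  refine tendsto_nhds_unique ?_ hlim1
  refine tendsto_integral_filter_of_dominated_convergence (fun _ => 1)
    (Eventually.of_forall fun n => ?_) (Eventually.of_forall fun n => Eventually.of_forall
      fun ω => norm_walkProd_le (fun j => (norm_stepPhase _ _ _ j).le) _ _ _)
    (integrable_const 1) ?_
  · exact ((measurable_walkProd _ n).comp ((measurable_pi_lambda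
      (fun ω (i : ℕ) => N (i * (t.toNNReal / n)) ω)
      fun i => hD.poisson.measurable _).prodMk hpair)).aestronglyMeasurable
  · filter_upwards [hD.poisson.rightCont, hD.poisson.mono] with ω hω hmono
    set f : ℤ → ℝ := fun j => xi * sumSign j + eta * diffSign j with hf
    have hfb : ∀ j, |f j| ≤ |xi| + |eta| := fun j => by
      refine (abs_add_le _ _).trans (le_of_eq ?_)
      rw [abs_mul, abs_mul, abs_sumSign, abs_diffSign, mul_one, mul_one]
    have hR := tendsto_right_riemann_sum ht (g := fun r => f (dirIndex N J₀ ε r ω))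
      (fun r => hfb _) (continuousWithinAt_comp_dirIndex hω f)
    have hI : ∫ r in (0 : ℝ)..t, f (dirIndex N J₀ ε r ω) =
        xi * (∫ r in (0 : ℝ)..t, sumSign (dirIndex N J₀ ε r ω)) +
        eta * ∫ r in (0 : ℝ)..t, diffSign (dirIndex N J₀ ε r ω) := by
      rw [← intervalIntegral.integral_const_mul, ← intervalIntegral.integral_const_mul,
        ← intervalIntegral.integral_add]
      · exact (intervalIntegrable_comp_dirIndex hmono sumSign
          (fun j => (abs_sumSign j).le) 0 t).const_mul xi
      · exact (intervalIntegrable_comp_dirIndex hmono diffSign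
          (fun j => (abs_diffSign j).le) 0 t).const_mul eta
    rw [hI] at hR
    have hexp : Continuous fun x : ℝ => Complex.exp ((x : ℂ) * Complex.I) := by fun_prop
    refine (hexp.continuousAt.tendsto.comp hR).congr fun n => ?_
    simp only [Function.comp_apply, hW, walkProd, stepPhase]
    rw [← Complex.exp_sum, Complex.ofReal_sum, Finset.sum_mul]
    refine congrArg Complex.exp (Finset.sum_congr rfl fun i _ => ?_)
    have harg : (((i + 1 : ℕ) : ℝ) * (t / n)).toNNReal = ((i + 1 : ℕ) : ℝ≥0) * (t.toNNReal / n) := by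
      rw [← hcast, ← NNReal.coe_natCast, ← NNReal.coe_mul, Real.toNNReal_coe]
    simp only [hf, dirIndex_eq_dirSum, harg]

/-- The two integrated signs are independent telegraph processes. -/
lemma map_eq_telegraphLaw_prod (hD : IsDirectionMechanism P lam N J₀ ε) {t : ℝ} (ht : 0 < t)
    {Z : Ω → ℝ × ℝ} (hZ : AEMeasurable Z P)
    (h : ∀ᵐ ω ∂P, Z ω = (∫ r in (0 : ℝ)..t, sumSign (dirIndex N J₀ ε r ω),
      ∫ r in (0 : ℝ)..t, diffSign (dirIndex N J₀ ε r ω))) :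
    P.map Z = (telegraphLaw lam t).prod (telegraphLaw lam t) := by
  have := Measure.isProbabilityMeasure_map hZ
  refine Measure.ext_of_charFunDual (funext fun L => ?_)
  have hL : ∀ a b : ℝ, L (a, b) = L (1, 0) * a + L (0, 1) * b := fun a b => by
    have : (a, b) = a • ((1 : ℝ), (0 : ℝ)) + b • ((0 : ℝ), (1 : ℝ)) := by simp
    rw [this, map_add, map_smul, map_smul, smul_eq_mul, smul_eq_mul]
    ring
  rw [charFunDual_prod, charFunDual_apply, charFunDual_apply, charFunDual_apply,
    integral_map hZ (by fun_prop)]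
  have h1 : ∀ x : ℝ, (L.comp (.inl ℝ ℝ ℝ)) x = L (1, 0) * x := fun x => by
    simpa using hL x 0
  have h2 : ∀ x : ℝ, (L.comp (.inr ℝ ℝ ℝ)) x = L (0, 1) * x := fun x => by
    simpa using hL 0 x
  simp only [h1, h2, Complex.ofReal_mul]
  rw [← charFun_apply_real, ← charFun_apply_real, charFun_telegraphLaw lam.coe_nonneg ht.le,
    charFun_telegraphLaw lam.coe_nonneg ht.le, ← integral_exp_integral_sign hD ht]
  refine integral_congr_ae ?_
  filter_upwards [h] with ω hω
  rw [hω, hL]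

end

/-! ### Travel times as coordinates -/

section TravelTime

variable {J : Set ℝ} {v : ℝ → ℝ}

lemma hasDerivAt_travelTime (hJo : IsOpen J) (hJc : J.OrdConnected) (hv : ContinuousOn v J)
    (hvpos : ∀ z ∈ J, 0 < v z) {a x : ℝ} (ha : a ∈ J) (hx : x ∈ J) :
    HasDerivAt (travelTime v a) (1 / v x) x := by
  have hc : ContinuousOn (fun z => 1 / v z) J :=
    continuousOn_const.div hv fun z hz => (hvpos z hz).ne'
  exact intervalIntegral.integral_hasDerivAt_right
    ((hc.mono (hJc.uIcc_subset ha hx)).intervalIntegrable)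
    (ContinuousOn.stronglyMeasurableAtFilter hJo hc x hx) (hc.continuousAt (hJo.mem_nhds hx))

lemma continuousOn_travelTime (hJo : IsOpen J) (hJc : J.OrdConnected) (hv : ContinuousOn v J)
    (hvpos : ∀ z ∈ J, 0 < v z) {a : ℝ} (ha : a ∈ J) : ContinuousOn (travelTime v a) J :=
  fun _ hx => (hasDerivAt_travelTime hJo hJc hv hvpos ha hx).continuousAt.continuousWithinAt

lemma strictMonoOn_travelTime (hJo : IsOpen J) (hJc : J.OrdConnected) (hv : ContinuousOn v J)
    (hvpos : ∀ z ∈ J, 0 < v z) {a : ℝ} (ha : a ∈ J) : StrictMonoOn (travelTime v a) J := by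
  refine strictMonoOn_of_deriv_pos hJc.convex (continuousOn_travelTime hJo hJc hv hvpos ha)
    fun x hx => ?_
  have hx := interior_subset hx
  rw [(hasDerivAt_travelTime hJo hJc hv hvpos ha hx).deriv]
  exact one_div_pos.mpr (hvpos x hx)

/-- The sum and the difference of the travel times of the two coordinates. -/
noncomputable def travelSumDiff (v : ℝ → ℝ) (x₀ y₀ : ℝ) (z : ℝ × ℝ) : ℝ × ℝ :=
  (travelTime v x₀ z.1 + travelTime v y₀ z.2, travelTime v x₀ z.1 - travelTime v y₀ z.2)

lemma injOn_travelSumDiff (hJo : IsOpen J) (hJc : J.OrdConnected) (hv : ContinuousOn v J)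
    (hvpos : ∀ z ∈ J, 0 < v z) {x₀ y₀ : ℝ} (hx₀ : x₀ ∈ J) (hy₀ : y₀ ∈ J) :
    InjOn (travelSumDiff v x₀ y₀) (J ×ˢ J) := by
  intro z hz w hw h
  simp only [travelSumDiff, Prod.mk.injEq] at h
  refine Prod.ext ((strictMonoOn_travelTime hJo hJc hv hvpos hx₀).injOn hz.1 hw.1 ?_)
    ((strictMonoOn_travelTime hJo hJc hv hvpos hy₀).injOn hz.2 hw.2 ?_) <;> linarith [h.1, h.2]

/-- The derivative of `travelSumDiff`. -/
noncomputable def fderivTravelSumDiff (v : ℝ → ℝ) (z : ℝ × ℝ) : ℝ × ℝ →L[ℝ] ℝ × ℝ :=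
  (Matrix.toLin (.finTwoProd ℝ) (.finTwoProd ℝ)
    !![1 / v z.1, 1 / v z.2; 1 / v z.1, -(1 / v z.2)]).toContinuousLinearMap

lemma hasFDerivAt_travelSumDiff (hJo : IsOpen J) (hJc : J.OrdConnected) (hv : ContinuousOn v J)
    (hvpos : ∀ z ∈ J, 0 < v z) {x₀ y₀ : ℝ} (hx₀ : x₀ ∈ J) (hy₀ : y₀ ∈ J) {z : ℝ × ℝ}
    (hz : z ∈ J ×ˢ J) :
    HasFDerivAt (travelSumDiff v x₀ y₀) (fderivTravelSumDiff v z) z := by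
  have h1 := (hasDerivAt_travelTime hJo hJc hv hvpos hx₀ hz.1).comp_hasFDerivAt z
    (hasFDerivAt_fst (𝕜 := ℝ) (p := z))
  have h2 := (hasDerivAt_travelTime hJo hJc hv hvpos hy₀ hz.2).comp_hasFDerivAt z
    (hasFDerivAt_snd (𝕜 := ℝ) (p := z))
  unfold fderivTravelSumDiff
  rw [Matrix.toLin_finTwoProd_toContinuousLinearMap]
  refine ((h1.add h2).prodMk (h1.sub h2)).congr_fderiv ?_
  ext <;> simp

lemma det_fderivTravelSumDiff (v : ℝ → ℝ) (z : ℝ × ℝ) :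
    (fderivTravelSumDiff v z).det = -(2 / (v z.1 * v z.2)) := by
  rw [fderivTravelSumDiff, LinearMap.det_toContinuousLinearMap, LinearMap.det_toLin,
    Matrix.det_fin_two_of]
  ring

end TravelTime

/-! ### The motion in travel-time coordinates -/

section Motion

variable {Ω : Type*} {J : Set ℝ} {v : ℝ → ℝ} {N : ℝ≥0 → Ω → ℕ} {J₀ : Ω → ℤ} {ε : ℕ → Ω → ℤ}

/-- Travel times along a path: if `x' = v(x) f(direction)` off the Poisson events, the travel time
is the integral of `f(direction)`. -/
lemma travelTime_eq_integral (hJo : IsOpen J) (hJc : J.OrdConnected) (hv : ContinuousOn v J)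
    (hvpos : ∀ z ∈ J, 0 < v z) {ω : Ω} (hmono : Monotone fun t => N t ω) {t : ℝ} (ht : 0 ≤ t)
    {x : ℝ → ℝ} (hxJ : ∀ s ∈ Icc 0 t, x s ∈ J) (hxc : ContinuousOn x (Icc 0 t)) {f : ℤ → ℝ}
    (hf : ∀ j, |f j| ≤ 1) (hx : ∀ s ∈ Ioo 0 t,
      (∀ᶠ r : ℝ in 𝓝 s, N r.toNNReal ω = N s.toNNReal ω) →
      HasDerivAt x (v (x s) * f (dirIndex N J₀ ε s ω)) s) :
    ∫ r in (0 : ℝ)..t, f (dirIndex N J₀ ε r ω) = travelTime v (x 0) (x t) := by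
  have h0 : x 0 ∈ J := hxJ 0 ⟨le_rfl, ht⟩
  have h := integral_eq_of_hasDerivAt_off_countable_of_le (fun s => travelTime v (x 0) (x s))
    (fun s => f (dirIndex N J₀ ε s ω)) ht (monotone_comp_toNNReal hmono).countable_not_continuousAt
    ((continuousOn_travelTime hJo hJc hv hvpos h0).comp hxc hxJ) ?_
    (intervalIntegrable_comp_dirIndex hmono f hf 0 t)
  · rw [h]
    simp [travelTime]
  · intro s hs
    have hsJ : x s ∈ J := hxJ s (Ioo_subset_Icc_self hs.1)
    have hcont : ContinuousAt (fun r : ℝ => N r.toNNReal ω) s := not_not.mp hs.2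
    -- Continuity of an integer-valued path at s means that it is constant near s, so the equation
    -- of motion applies; the monotone path has only countably many other points.
    have hloc : ∀ᶠ r : ℝ in 𝓝 s, N r.toNNReal ω = N s.toNNReal ω :=
      hcont.eventually_mem (isOpen_discrete {N s.toNNReal ω} |>.mem_nhds rfl)
    refine ((hasDerivAt_travelTime hJo hJc hv hvpos h0 hsJ).comp s
      (hx s hs.1 hloc)).congr_deriv ?_
    rw [← mul_assoc, one_div_mul_cancel (hvpos _ hsJ).ne', one_mul]

variable [MeasurableSpace Ω] {P : Measure Ω} {lam : ℝ≥0} {x₀ y₀ T : ℝ} {X Y : ℝ → Ω → ℝ}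

lemma IsPlanarMotion.ae_travelSumDiff_eq (hD : IsDirectionMechanism P lam N J₀ ε)
    (hXY : IsPlanarMotion P J v N J₀ ε x₀ y₀ T X Y) (hJo : IsOpen J) (hJc : J.OrdConnected)
    (hv : ContinuousOn v J) (hvpos : ∀ z ∈ J, 0 < v z) {t : ℝ} (ht : 0 ≤ t) (htT : t ≤ T) :
    ∀ᵐ ω ∂P, travelSumDiff v x₀ y₀ (X t ω, Y t ω) =
      (∫ r in (0 : ℝ)..t, sumSign (dirIndex N J₀ ε r ω),
        ∫ r in (0 : ℝ)..t, diffSign (dirIndex N J₀ ε r ω)) := by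
  filter_upwards [hD.poisson.mono, hXY.init, hXY.mem, hXY.cont, hXY.motion]
    with ω hmono hinit hmem hcont hmot
  have hsub : Icc 0 t ⊆ Icc 0 T := Icc_subset_Icc_right htT
  have hcos : ∀ j : ℤ, |Real.cos (Real.pi * (j : ℝ) / 2)| ≤ 1 := fun j => Real.abs_cos_le_one _
  have hsin : ∀ j : ℤ, |Real.sin (Real.pi * (j : ℝ) / 2)| ≤ 1 := fun j => Real.abs_sin_le_one _
  have hX := travelTime_eq_integral (J₀ := J₀) (ε := ε) hJo hJc hv hvpos hmono ht
    (x := fun s => X s ω) (fun s hs => (hmem s (hsub hs)).1) (hcont.1.mono hsub) hcos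
    (fun s hs h => (hmot s ⟨hs.1, hs.2.trans_le htT⟩ h).1)
  have hY := travelTime_eq_integral (J₀ := J₀) (ε := ε) hJo hJc hv hvpos hmono ht
    (x := fun s => Y s ω) (fun s hs => (hmem s (hsub hs)).2) (hcont.2.mono hsub) hsin
    (fun s hs h => (hmot s ⟨hs.1, hs.2.trans_le htT⟩ h).2)
  rw [hinit.1] at hX
  rw [hinit.2] at hY
  have iX := intervalIntegrable_comp_dirIndex (J₀ := J₀) (ε := ε) hmono _ hcos 0 t
  have iY := intervalIntegrable_comp_dirIndex (J₀ := J₀) (ε := ε) hmono _ hsin 0 t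
  rw [travelSumDiff, ← hX, ← hY, ← intervalIntegral.integral_add iX iY,
    ← intervalIntegral.integral_sub iX iY]
  rfl

/-- The travel time is controlled only on J, so measurability holds up to the null set where Z
leaves J. -/
lemma aemeasurable_travelTime_comp (hJo : IsOpen J) (hJc : J.OrdConnected) (hv : ContinuousOn v J)
    (hvpos : ∀ z ∈ J, 0 < v z) {a : ℝ} (ha : a ∈ J) {Z : Ω → ℝ} (hZ : Measurable Z)
    (hZJ : ∀ᵐ ω ∂P, Z ω ∈ J) : AEMeasurable (fun ω => travelTime v a (Z ω)) P := by
  have h : AEMeasurable (travelTime v a) ((P.map Z).restrict J) :=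
    (continuousOn_travelTime hJo hJc hv hvpos ha).aemeasurable hJo.measurableSet
  rw [Measure.restrict_eq_self_of_ae_mem
    ((ae_map_iff hZ.aemeasurable hJo.measurableSet).mpr hZJ)] at h
  exact h.comp_measurable hZ

variable [IsProbabilityMeasure P]

lemma IsPlanarMotion.map_travelSumDiff (hD : IsDirectionMechanism P lam N J₀ ε)
    (hXY : IsPlanarMotion P J v N J₀ ε x₀ y₀ T X Y) (hJo : IsOpen J) (hJc : J.OrdConnected)
    (hv : ContinuousOn v J) (hvpos : ∀ z ∈ J, 0 < v z) (hx₀ : x₀ ∈ J) (hy₀ : y₀ ∈ J)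
    {t : ℝ} (ht : 0 < t) (htT : t ≤ T) :
    AEMeasurable (fun ω => travelSumDiff v x₀ y₀ (X t ω, Y t ω)) P ∧
      P.map (fun ω => travelSumDiff v x₀ y₀ (X t ω, Y t ω)) =
        (telegraphLaw lam t).prod (telegraphLaw lam t) := by
  have htmem : t ∈ Icc 0 T := ⟨ht.le, htT⟩
  have hX := aemeasurable_travelTime_comp hJo hJc hv hvpos hx₀ (hXY.measurable_X t htmem)
    (hXY.mem.mono fun ω h => (h t htmem).1)
  have hY := aemeasurable_travelTime_comp hJo hJc hv hvpos hy₀ (hXY.measurable_Y t htmem)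
    (hXY.mem.mono fun ω h => (h t htmem).2)
  have hZ : AEMeasurable (fun ω => travelSumDiff v x₀ y₀ (X t ω, Y t ω)) P :=
    (hX.add hY).prodMk (hX.sub hY)
  exact ⟨hZ, map_eq_telegraphLaw_prod hD ht hZ
    (hXY.ae_travelSumDiff_eq hD hJo hJc hv hvpos ht.le htT)⟩

/-- The interior of the support lies in the image of the open diamond. -/
lemma IsPlanarMotion.mem_of_mem_interior_support (hD : IsDirectionMechanism P lam N J₀ ε)
    (hXY : IsPlanarMotion P J v N J₀ ε x₀ y₀ T X Y) (hJo : IsOpen J) (hJc : J.OrdConnected)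
    (hv : ContinuousOn v J) (hvpos : ∀ z ∈ J, 0 < v z) (hx₀ : x₀ ∈ J) (hy₀ : y₀ ∈ J)
    {t : ℝ} (ht : 0 < t) (htT : t ≤ T) {z : ℝ × ℝ}
    (hz : z ∈ interior (P.map (fun ω => (X t ω, Y t ω))).support) :
    z ∈ J ×ˢ J ∧ travelSumDiff v x₀ y₀ z ∈ Ioo (-t) t ×ˢ Ioo (-t) t := by
  obtain ⟨hZ, hlaw⟩ := hXY.map_travelSumDiff hD hJo hJc hv hvpos hx₀ hy₀ ht htT
  have htmem : t ∈ Icc 0 T := ⟨ht.le, htT⟩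
  have hmonox := strictMonoOn_travelTime hJo hJc hv hvpos hx₀
  have hmonoy := strictMonoOn_travelTime hJo hJc hv hvpos hy₀
  have hmemJ : ∀ᵐ ω ∂P, (X t ω, Y t ω) ∈ J ×ˢ J := hXY.mem.mono fun ω h => h t htmem
  -- A pair of atoms has positive mass under the product law, so some sample point realises it by a
  -- position in J × J.
  have hex : ∀ s s' : ℝ, telegraphLaw lam t {s} ≠ 0 → telegraphLaw lam t {s'} ≠ 0 →
      ∃ z ∈ J ×ˢ J, travelSumDiff v x₀ y₀ z = (s, s') := by
    intro s s' hs hs'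
    have hne : P.map (fun ω => travelSumDiff v x₀ y₀ (X t ω, Y t ω)) {(s, s')} ≠ 0 := by
      rw [hlaw, ← singleton_prod_singleton, Measure.prod_prod]
      exact mul_ne_zero hs hs'
    rw [Measure.map_apply_of_aemeasurable hZ (measurableSet_singleton _)] at hne
    have hfreq : ∃ᵐ ω ∂P, travelSumDiff v x₀ y₀ (X t ω, Y t ω) = (s, s') :=
      frequently_ae_iff.mpr hne
    obtain ⟨ω, h1, h2⟩ := (hfreq.and_eventually hmemJ).exists
    exact ⟨_, h2, h1⟩
  -- The four corners of the square correspond to (U, V) = (±t, 0) and (0, ±t). Hence the travel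
  -- times ±t are attained inside J, at x1, x2 and y1, y2.
  obtain ⟨hp, hn⟩ := telegraphLaw_singleton_ne_zero lam t
  obtain ⟨⟨x1, u1⟩, hx1, e1⟩ := hex t t hp hp
  obtain ⟨⟨x2, u2⟩, hx2, e2⟩ := hex (-t) (-t) hn hn
  obtain ⟨⟨u3, y1⟩, hy1, e3⟩ := hex t (-t) hp hn
  obtain ⟨⟨u4, y2⟩, hy2, e4⟩ := hex (-t) t hn hp
  simp only [travelSumDiff, Prod.mk.injEq] at e1 e2 e3 e4
  replace hx1 := hx1.1
  replace hx2 := hx2.1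
  replace hy1 := hy1.2
  replace hy2 := hy2.2
  -- Restricting to a compact box inside J × J makes K closed in the whole plane, although J need
  -- not be closed; K then contains the support.
  set K : Set (ℝ × ℝ) := (Icc x2 x1 ×ˢ Icc y2 y1) ∩
    travelSumDiff v x₀ y₀ ⁻¹' (Icc (-t) t ×ˢ Icc (-t) t) with hK
  have hbox : Icc x2 x1 ×ˢ Icc y2 y1 ⊆ J ×ˢ J :=
    prod_mono (hJc.out hx2 hx1) (hJc.out hy2 hy1)
  have hKc : IsClosed K := by
    refine ContinuousOn.preimage_isClosed_of_isClosed (fun z hz => ?_)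
      (isClosed_Icc.prod isClosed_Icc) (isClosed_Icc.prod isClosed_Icc)
    exact (hasFDerivAt_travelSumDiff hJo hJc hv hvpos hx₀ hy₀
      (hbox hz)).continuousAt.continuousWithinAt
  have hae : ∀ᵐ ω ∂P, travelSumDiff v x₀ y₀ (X t ω, Y t ω) ∈ Icc (-t) t ×ˢ Icc (-t) t := by
    have hcl := telegraphLaw_compl_Icc (lam := lam) ht.le
    have h := (Measure.ae_prod_mem_iff_ae_ae_mem (μ := telegraphLaw lam t)
      (ν := telegraphLaw lam t) (s := Icc (-t) t ×ˢ Icc (-t) t)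
      (measurableSet_Icc.prod measurableSet_Icc)).mpr (by
        have h0 : ∀ᵐ a ∂telegraphLaw lam t, a ∈ Icc (-t) t := hcl
        filter_upwards [h0] with a ha
        filter_upwards [h0] with b hb
        exact ⟨ha, hb⟩)
    rw [← hlaw] at h
    exact ae_of_ae_map hZ h
  have hRK : (P.map (fun ω => (X t ω, Y t ω))).support ⊆ K := by
    refine Measure.support_subset_of_isClosed hKc ?_
    have hm : AEMeasurable (fun ω => (X t ω, Y t ω)) P :=
      ((hXY.measurable_X t htmem).prodMk (hXY.measurable_Y t htmem)).aemeasurable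
    refine (ae_map_iff hm hKc.measurableSet).mpr ?_
    filter_upwards [hae, hmemJ] with ω h1 h2
    have h3 := h1
    simp only [travelSumDiff, mem_prod, mem_Icc] at h3
    refine ⟨⟨⟨?_, ?_⟩, ?_, ?_⟩, h1⟩
    · exact (hmonox.le_iff_le hx2 h2.1).mp (by linarith [h3.1.1, h3.2.1])
    · exact (hmonox.le_iff_le h2.1 hx1).mp (by linarith [h3.1.2, h3.2.2])
    · exact (hmonoy.le_iff_le hy2 h2.2).mp (by linarith [h3.1.1, h3.2.2])
    · exact (hmonoy.le_iff_le h2.2 hy1).mp (by linarith [h3.1.2, h3.2.1])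
  have hzK : K ∈ 𝓝 z := mem_interior_iff_mem_nhds.mp (interior_mono hRK hz)
  have hzJ : z ∈ J ×ˢ J := hbox (mem_of_mem_nhds hzK).1
  -- A horizontal shift changes U + V and U - V strictly and in the same sense. As small shifts both
  -- ways stay in K, neither coordinate at z can equal ±t.
  have hshift : ∀ᶠ d : ℝ in 𝓝 0, (z.1 + d, z.2) ∈ K := by
    have hc : Tendsto (fun d : ℝ => (z.1 + d, z.2)) (𝓝 0) (𝓝 z) := by
      have : Continuous fun d : ℝ => (z.1 + d, z.2) := by fun_prop
      simpa using this.tendsto 0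
    exact hc hzK
  obtain ⟨d, hd, hdK⟩ := Metric.eventually_nhds_iff.mp hshift
  have h1 := @hdK (d / 2) (by rw [Real.dist_eq, sub_zero, abs_of_pos (by linarith)]; linarith)
  have h2 := @hdK (-(d / 2)) (by
    rw [Real.dist_eq, sub_zero, abs_neg, abs_of_pos (by linarith)]; linarith)
  have m1 := hmonox hzJ.1 (hbox h1.1).1 (by linarith : z.1 < z.1 + d / 2)
  have m2 := hmonox (hbox h2.1).1 hzJ.1 (by linarith : z.1 + -(d / 2) < z.1)
  have b1 := h1.2
  have b2 := h2.2
  simp only [travelSumDiff, mem_preimage, mem_prod, mem_Icc] at b1 b2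
  refine ⟨hzJ, ⟨?_, ?_⟩, ?_, ?_⟩ <;> simp only [travelSumDiff]
  · linarith [b2.1.1]
  · linarith [b1.1.2]
  · linarith [b2.2.1]
  · linarith [b1.2.2]

end Motion

/-! ### Change of variables and conclusion -/

lemma telegraphLaw_prod_restrict (lam t : ℝ) :
    ((telegraphLaw lam t).prod (telegraphLaw lam t)).restrict (Ioo (-t) t ×ˢ Ioo (-t) t) =
      (volume.restrict (Ioo (-t) t ×ˢ Ioo (-t) t)).withDensity fun p : ℝ × ℝ =>
        ENNReal.ofReal (telegraphDensity lam t p.1) *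
          ENNReal.ofReal (telegraphDensity lam t p.2) := by
  rw [← Measure.prod_restrict, telegraphLaw_restrict_Ioo, prod_withDensity (by fun_prop)
    (by fun_prop), Measure.prod_restrict]
  rfl

lemma integrableOn_telegraphDensity_mul (lam t : ℝ) :
    IntegrableOn (fun p : ℝ × ℝ => telegraphDensity lam t p.1 * telegraphDensity lam t p.2)
      (Ioo (-t) t ×ˢ Ioo (-t) t) := by
  have hc : Continuous fun p : ℝ × ℝ => telegraphDensity lam t p.1 * telegraphDensity lam t p.2 := by
    fun_prop
  exact (hc.continuousOn.integrableOn_compact (isCompact_Icc.prod isCompact_Icc)).mono_set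
    (prod_mono Ioo_subset_Icc_self Ioo_subset_Icc_self)

lemma telegraphLaw_prod_real_apply {lam t : ℝ} (hlam : 0 ≤ lam) (ht : 0 ≤ t) {B : Set (ℝ × ℝ)}
    (hB : MeasurableSet B) (hBs : B ⊆ Ioo (-t) t ×ˢ Ioo (-t) t) :
    ((telegraphLaw lam t).prod (telegraphLaw lam t)).real B =
      ∫ p in B, telegraphDensity lam t p.1 * telegraphDensity lam t p.2 := by
  have hnn : ∀ p ∈ Ioo (-t) t ×ˢ Ioo (-t) t, 0 ≤ telegraphDensity lam t p.1 ∧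
      0 ≤ telegraphDensity lam t p.2 := fun p hp =>
    ⟨telegraphDensity_nonneg hlam ht (abs_le.mpr ⟨hp.1.1.le, hp.1.2.le⟩),
      telegraphDensity_nonneg hlam ht (abs_le.mpr ⟨hp.2.1.le, hp.2.2.le⟩)⟩
  have h : ((telegraphLaw lam t).prod (telegraphLaw lam t)) B =
      ∫⁻ p in B, ENNReal.ofReal (telegraphDensity lam t p.1 * telegraphDensity lam t p.2) := by
    rw [← Measure.restrict_eq_self _ hBs, telegraphLaw_prod_restrict, withDensity_apply _ hB,
      Measure.restrict_restrict hB, inter_eq_left.mpr hBs]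
    exact setLIntegral_congr_fun hB fun p hp => (ENNReal.ofReal_mul (hnn p (hBs hp)).1).symm
  rw [measureReal_def, h, integral_eq_lintegral_of_nonneg_ae]
  · exact (ae_restrict_iff' hB).mpr (Eventually.of_forall fun p hp =>
      mul_nonneg (hnn p (hBs hp)).1 (hnn p (hBs hp)).2)
  · have hc : Continuous fun p : ℝ × ℝ =>
        telegraphDensity lam t p.1 * telegraphDensity lam t p.2 := by fun_prop
    exact hc.aestronglyMeasurable

/-- The two factors e^{-lam t/2}/2 multiply to e^{-lam t}/4, and the Jacobian 2/(v(x) v(y)) restores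
the constant 1/2. -/
lemma planarDensity_eq {lam t : ℝ} {v : ℝ → ℝ} {x₀ y₀ : ℝ} {z : ℝ × ℝ} (h1 : 0 < v z.1)
    (h2 : 0 < v z.2) (hz : travelSumDiff v x₀ y₀ z ∈ Ioo (-t) t ×ˢ Ioo (-t) t) :
    planarDensity lam v x₀ y₀ t z = |(fderivTravelSumDiff v z).det| •
      (telegraphDensity lam t (travelSumDiff v x₀ y₀ z).1 *
        telegraphDensity lam t (travelSumDiff v x₀ y₀ z).2) := by
  have e1 := besselFactor_eq lam (abs_lt.mpr hz.1)
  have e2 := besselFactor_eq lam (abs_lt.mpr hz.2)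
  simp only [travelSumDiff] at e1 e2
  rw [planarDensity, e1, e2, det_fderivTravelSumDiff, abs_neg, abs_of_pos (by positivity), smul_eq_mul, telegraphDensity,
    telegraphDensity, show -lam * t = -(lam / 2) * t + -(lam / 2) * t by ring, Real.exp_add]
  simp only [travelSumDiff]
  field_simp

theorem mainTheorem4 {Ω : Type*} [MeasurableSpace Ω] (P : Measure Ω) [IsProbabilityMeasure P]
    (J : Set ℝ) (hJo : IsOpen J) (hJc : J.OrdConnected)
    (v : ℝ → ℝ) (hv : ContDiffOn ℝ 1 v J) (hvpos : ∀ z ∈ J, 0 < v z)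
    (lam : ℝ≥0) (hlam : 0 < lam) (x₀ y₀ : ℝ) (hx₀ : x₀ ∈ J) (hy₀ : y₀ ∈ J)
    (N : ℝ≥0 → Ω → ℕ) (J₀ : Ω → ℤ) (ε : ℕ → Ω → ℤ)
    (hD : IsDirectionMechanism P lam N J₀ ε)
    (T : ℝ) (X Y : ℝ → Ω → ℝ) (hXY : IsPlanarMotion P J v N J₀ ε x₀ y₀ T X Y)
    (t : ℝ) (ht : 0 < t) (htT : t ≤ T)
    (R : Set (ℝ × ℝ)) (hR : R = (P.map (fun ω => (X t ω, Y t ω))).support) :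
    (∀ z ∈ interior R, z.1 ∈ J ∧ z.2 ∈ J ∧
      DifferentiableAt ℝ (besselTerm lam (travelTime v x₀ z.1 + travelTime v y₀ z.2)) t ∧
      DifferentiableAt ℝ (besselTerm lam (travelTime v x₀ z.1 - travelTime v y₀ z.2)) t) ∧
    IntegrableOn (planarDensity lam v x₀ y₀ t) (interior R) ∧
    ∀ A : Set (ℝ × ℝ), MeasurableSet A → A ⊆ interior R →
      P.real {ω | (X t ω, Y t ω) ∈ A} = ∫ z in A, planarDensity lam v x₀ y₀ t z := by
  have hvc := hv.continuousOn
  have htmem : t ∈ Icc 0 T := ⟨ht.le, htT⟩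
  obtain ⟨hZ, hlaw⟩ := hXY.map_travelSumDiff hD hJo hJc hvc hvpos hx₀ hy₀ ht htT
  have hint : ∀ z ∈ interior R, z ∈ J ×ˢ J ∧
      travelSumDiff v x₀ y₀ z ∈ Ioo (-t) t ×ˢ Ioo (-t) t := fun z hz =>
    hXY.mem_of_mem_interior_support hD hJo hJc hvc hvpos hx₀ hy₀ ht htT (hR ▸ hz)
  have hderiv : ∀ A ⊆ interior R, ∀ z ∈ A,
      HasFDerivWithinAt (travelSumDiff v x₀ y₀) (fderivTravelSumDiff v z) A z := fun A hA z hz =>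
    (hasFDerivAt_travelSumDiff hJo hJc hvc hvpos hx₀ hy₀ (hint z (hA hz)).1).hasFDerivWithinAt
  have hinj : InjOn (travelSumDiff v x₀ y₀) (J ×ˢ J) :=
    injOn_travelSumDiff hJo hJc hvc hvpos hx₀ hy₀
  let g : ℝ × ℝ → ℝ := fun p => telegraphDensity lam t p.1 * telegraphDensity lam t p.2
  have hdens : ∀ z ∈ interior R, planarDensity lam v x₀ y₀ t z =
      |(fderivTravelSumDiff v z).det| • g (travelSumDiff v x₀ y₀ z) := fun z hz =>
    planarDensity_eq (hvpos _ (hint z hz).1.1) (hvpos _ (hint z hz).1.2) (hint z hz).2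
  refine ⟨fun z hz => ?_, ?_, fun A hA hAR => ?_⟩
  · obtain ⟨hzJ, hz⟩ := hint z hz
    exact ⟨hzJ.1, hzJ.2,
      (hasDerivAt_besselTerm (lam : ℝ) (abs_lt.mpr hz.1)).differentiableAt,
      (hasDerivAt_besselTerm (lam : ℝ) (abs_lt.mpr hz.2)).differentiableAt⟩
  · rw [integrableOn_congr_fun hdens isOpen_interior.measurableSet,
      ← integrableOn_image_iff_integrableOn_abs_det_fderiv_smul volume
        isOpen_interior.measurableSet (hderiv _ subset_rfl) (hinj.mono fun z hz => (hint z hz).1) g]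
    exact (integrableOn_telegraphDensity_mul lam t).mono_set
      (image_subset_iff.mpr fun z hz => (hint z hz).2)
  · have hAinj : InjOn (travelSumDiff v x₀ y₀) A := hinj.mono fun z hz => (hint z (hAR hz)).1
    have himg : MeasurableSet (travelSumDiff v x₀ y₀ '' A) :=
      measurable_image_of_fderivWithin hA (hderiv A hAR) hAinj
    rw [setIntegral_congr_fun hA fun z hz => hdens z (hAR hz),
      ← integral_image_eq_integral_abs_det_fderiv_smul volume hA (hderiv A hAR) hAinj g,
      ← telegraphLaw_prod_real_apply lam.coe_nonneg ht.le himg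
        (image_subset_iff.mpr fun z hz => (hint z (hAR hz)).2), ← hlaw,
      measureReal_def, measureReal_def, Measure.map_apply_of_aemeasurable hZ himg]
    congr 1
    -- Almost surely the position lies in J × J, where the coordinate map is injective; there,
    -- having its image in that of A is the same as lying in A.
    refine measure_congr ?_
    filter_upwards [hXY.mem] with ω hω
    refine propext ⟨fun h => mem_image_of_mem _ h, ?_⟩
    rintro ⟨z, hz, hzω⟩
    have := hinj (hint z (hAR hz)).1 (⟨(hω t htmem).1, (hω t htmem).2⟩ :
      (X t ω, Y t ω) ∈ J ×ˢ J) hzω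
    exact (this ▸ hz : (X t ω, Y t ω) ∈ A)
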